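/- Let $n\ge 3$. Let $T_n$ be the complex of trees: the abstract simplicial complex whose maximal simplices are given by the combinatorial types (isomorphism classes under root- and label-preserving isomorphism) of binary rooted trees with $n$ leaves labelled $1,\dots,n$, and whose lower-dimensional simplices are given by the rooted labelled trees obtained from these by contracting at most $n-3$ of the $n-2$ internal edges (edges not adjacent to a leaf); a simplex is identified with the set of its vertices, i.e. the trees obtained from it by contracting all internal edges but one. Let $\Pi_n$ be the lattice of set partitions of $\{1,\dots,n\}$ (with the partition into singletons as minimum), and let $\widetilde H_*(\Pi_n)$ denote the reduced simplicial homology of the order complex $\Delta(\Pi_n)$ of its proper part $\Pi_n\setminus\{\hat 0,\hat 1\}$. The symmetric group $\Sigma_n$ acts on $T_n$ by permuting leaf labels and on $\Pi_n$ by permuting $\{1,\dots,n\}$, hence on reduced homology. Then, with coefficients in $\mathbb Z$ (and, more generally, in any commutative ring $R$), the top degree reduced homology groups are isomorphic as $\Sigma_n$-modules: $$\widetilde H_{n-3}(T_n)\;\cong_{\Sigma_n}\;\widetilde H_{n-3}(\Pi_n).$$ -/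

import Mathlib

/-! ### Reduced simplicial homology with a group action

A `p`-tuple `v : Fin p → ι` of vertices stands for the oriented simplex `[v 0, …, v (p - 1)]` of
dimension `p - 1`; for `p = 0` it is the empty simplex, which lives in the augmentation degree.
A simplicial chain is a finitely supported function `c` on oriented simplices that changes sign
when the orientation is reversed. The chain written `[v 0, …, v (p - 1)]` in textbooks is the
function with value `sign π` at `v ∘ π` and `0` elsewhere. -/

namespace SimplicialHomology

variable {ι : Type*}

/-- The quotient `Z / B`, for submodules `B ≤ Z` of `M`. -/
abbrev Subquotient {R M : Type*} [CommRing R] [AddCommGroup M] [Module R M]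
    (Z B : Submodule R M) : Type _ :=
  Z ⧸ B.submoduleOf Z

/-- The representation on `Z / B` induced by a representation on `M` that preserves `Z` and `B`. -/
def subquotientRep {R M G : Type*} [CommRing R] [AddCommGroup M] [Module R M] [Group G]
    (ρ : Representation R G M) (Z B : Submodule R M) (hZ : ∀ g, Z ≤ Z.comap (ρ g))
    (hB : ∀ g, B ≤ B.comap (ρ g)) : Representation R G (Subquotient Z B) :=
  (ρ.subrepresentation Z hZ).quotient (B.submoduleOf Z) fun g _ hx => hB g hx

/-- The entries of `v` are distinct and are the vertices of a face of `K` (or of the empty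
simplex). -/
def IsFaceTuple (K : PreAbstractSimplicialComplex ι) {p : ℕ} (v : Fin p → ι) : Prop :=
  Function.Injective v ∧ (p = 0 ∨ ∃ s ∈ K.faces, (s : Set ι) = Set.range v)

/-- The `R`-module of oriented simplicial chains spanned by the simplices of `K` with `p` vertices,
i.e. of dimension `p - 1`. -/
def chains (R : Type*) [CommRing R] (K : PreAbstractSimplicialComplex ι) (p : ℕ) :
    Submodule R ((Fin p → ι) →₀ R) where
  carrier := {c | (∀ v, c v ≠ 0 → IsFaceTuple K v) ∧
    ∀ (π : Equiv.Perm (Fin p)) (v : Fin p → ι),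
      c (v ∘ π) = ((Equiv.Perm.sign π : ℤˣ) : ℤ) • c v}
  zero_mem' := by simp
  add_mem' := by
    rintro a b ⟨ha, ha'⟩ ⟨hb, hb'⟩
    refine ⟨fun v hv => ?_, fun π v => ?_⟩
    · by_cases h : a v = 0
      · exact hb v (by simpa [h] using hv)
      · exact ha v h
    · simp [ha' π v, hb' π v]
  smul_mem' := by
    rintro r a ⟨ha, ha'⟩
    refine ⟨fun v hv => ha v (fun h => hv (by simp [h])), fun π v => ?_⟩
    simp only [Finsupp.smul_apply, ha' π v]
    exact smul_comm _ _ _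

/-- The boundary operator: the coefficient of `∂ c` at `(w 0, …, w (p - 1))` is
`∑ x, c (x, w 0, …, w (p - 1))`. On `[v 0, …, v p]` this is the usual alternating sum of the
`[v 0, …, omit v i, …, v p]`; for `p = 0` it is the augmentation. -/
noncomputable def boundary (R : Type*) [CommRing R] (ι : Type*) (p : ℕ) :
    ((Fin (p + 1) → ι) →₀ R) →ₗ[R] ((Fin p → ι) →₀ R) :=
  Finsupp.lmapDomain R R Fin.tail

/-- The cycles with `p + 1` vertices, i.e. of dimension `p` (augmented for `p = 0`). -/
noncomputable def cycles (R : Type*) [CommRing R] (K : PreAbstractSimplicialComplex ι) (p : ℕ) :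
    Submodule R ((Fin (p + 1) → ι) →₀ R) :=
  chains R K (p + 1) ⊓ LinearMap.ker (boundary R ι p)

/-- The boundaries of dimension `p`. -/
noncomputable def boundaries (R : Type*) [CommRing R] (K : PreAbstractSimplicialComplex ι)
    (p : ℕ) : Submodule R ((Fin (p + 1) → ι) →₀ R) :=
  (chains R K (p + 2)).map (boundary R ι (p + 1))

theorem boundary_apply {R : Type*} [CommRing R] {p : ℕ} (c : (Fin (p + 1) → ι) →₀ R)
    (w : Fin p → ι) : boundary R ι p c w = c.sum fun v r => by
      classical exact if Fin.tail v = w then r else 0 := by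
  classical
  simp only [boundary, Finsupp.lmapDomain_apply, Finsupp.mapDomain, Finsupp.sum_apply,
    Finsupp.single_apply]

/-- The boundary of a chain is a chain. -/
theorem boundary_mem_chains {R : Type*} [CommRing R] (K : PreAbstractSimplicialComplex ι) {p : ℕ}
    {c : (Fin (p + 1) → ι) →₀ R} (hc : c ∈ chains R K (p + 1)) :
    boundary R ι p c ∈ chains R K p := by
  classical
  obtain ⟨h1, h2⟩ := hc
  refine ⟨fun w hw => ?_, fun π w => ?_⟩
  · rw [boundary_apply] at hw
    obtain ⟨v, hv, hvw⟩ := Finset.exists_ne_zero_of_sum_ne_zero hw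
    have hvw' : Fin.tail v = w := by
      by_contra h
      simp [h] at hvw
    subst hvw'
    obtain ⟨hinj, hf⟩ := h1 v (Finsupp.mem_support_iff.mp hv)
    refine ⟨fun i j hij => Fin.succ_injective _ (hinj hij), ?_⟩
    rcases Nat.eq_zero_or_pos p with hp | hp
    · exact Or.inl hp
    · right
      rcases hf with hf | ⟨s, hs, hsv⟩
      · omega
      · refine ⟨Finset.univ.image (Fin.tail v), ?_, by simp⟩
        refine (K.isRelLowerSet_faces hs).2 ?_ ?_
        · intro x hx
          obtain ⟨i, -, rfl⟩ := Finset.mem_image.mp hx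
          have : Fin.tail v i ∈ (s : Set ι) := by rw [hsv]; exact ⟨i.succ, rfl⟩
          exact this
        · exact ⟨Fin.tail v ⟨0, hp⟩, Finset.mem_image_of_mem _ (Finset.mem_univ _)⟩
  · set π' : Equiv.Perm (Fin (p + 1)) := Equiv.Perm.decomposeFin.symm (0, π) with hπ'
    have hsign : Equiv.Perm.sign π' = Equiv.Perm.sign π := by
      simp [hπ', Equiv.Perm.decomposeFin.symm_sign]
    have htail : ∀ v : Fin (p + 1) → ι, Fin.tail (v ∘ π') = Fin.tail v ∘ π := by
      intro v
      funext i
      simp [Fin.tail, hπ', Equiv.Perm.decomposeFin_symm_apply_succ]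
    have key : ∀ v, c (v ∘ π') = ((Equiv.Perm.sign π : ℤˣ) : ℤ) • c v := by
      intro v
      rw [h2 π' v, hsign]
    rw [boundary_apply, boundary_apply, Finsupp.sum, Finsupp.sum, Finset.smul_sum]
    symm
    have hunit : IsUnit (((Equiv.Perm.sign π : ℤˣ) : ℤ)) := Units.isUnit _
    refine Finset.sum_nbij' (fun v => v ∘ π') (fun v => v ∘ π'.symm) ?_ ?_ ?_ ?_ ?_
    · intro v hv
      rw [Finsupp.mem_support_iff] at hv ⊢
      rw [key]
      rcases Int.units_eq_one_or (Equiv.Perm.sign π) with h | h <;> simpa [h] using hv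
    · intro v hv
      rw [Finsupp.mem_support_iff] at hv ⊢
      have h3 := key (v ∘ π'.symm)
      have h4 : (v ∘ π'.symm) ∘ π' = v := by funext i; simp
      rw [h4] at h3
      intro h
      exact hv (by rw [h3, h, smul_zero])
    · intro v _
      funext i
      simp
    · intro v _
      funext i
      simp
    · intro v _
      simp only [htail, key]
      have : Fin.tail v ∘ π = w ∘ π ↔ Fin.tail v = w :=
        π.surjective.injective_comp_right.eq_iff
      simp only [this]
      split_ifs <;> simp

/-- `∂ ∘ ∂ = 0` on chains. -/
theorem boundary_boundary {R : Type*} [CommRing R] (K : PreAbstractSimplicialComplex ι) {p : ℕ}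
    {c : (Fin (p + 2) → ι) →₀ R} (hc : c ∈ chains R K (p + 2)) :
    boundary R ι p (boundary R ι (p + 1) c) = 0 := by
  classical
  obtain ⟨h1, h2⟩ := hc
  ext w
  simp only [boundary, Finsupp.lmapDomain_apply, ← Finsupp.mapDomain_comp]
  simp only [Finsupp.mapDomain, Finsupp.sum_apply, Finsupp.single_apply, Finsupp.coe_zero,
    Pi.zero_apply]
  rw [Finsupp.sum]
  have h01 : (0 : Fin (p + 2)) ≠ 1 := by simp
  have hs : ∀ v, c (v ∘ Equiv.swap (0 : Fin (p + 2)) 1) = - c v := by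
    intro v
    rw [h2, Equiv.Perm.sign_swap h01]
    simp
  have ht : ∀ v : Fin (p + 2) → ι,
      Fin.tail (Fin.tail (v ∘ Equiv.swap (0 : Fin (p + 2)) 1)) = Fin.tail (Fin.tail v) := by
    intro v
    funext i
    simp only [Fin.tail, Function.comp]
    rw [Equiv.swap_apply_of_ne_of_ne (Fin.succ_ne_zero _)]
    intro h
    rw [← Fin.succ_zero_eq_one] at h
    exact Fin.succ_ne_zero _ (Fin.succ_injective _ h)
  refine Finset.sum_involution (fun v _ => v ∘ Equiv.swap (0 : Fin (p + 2)) 1) ?_ ?_ ?_ ?_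
  · intro v _
    simp only [Function.comp_apply, ht, hs]
    split_ifs <;> simp
  · intro v hv _ heq
    have hinj := (h1 v (Finsupp.mem_support_iff.mp hv)).1
    have := congrFun heq 0
    simp only [Function.comp_apply, Equiv.swap_apply_left] at this
    exact h01 (hinj this).symm
  · intro v hv
    rw [Finsupp.mem_support_iff] at hv ⊢
    rw [hs]
    exact neg_ne_zero.mpr hv
  · intro v _
    funext i
    simp

/-- Every boundary is a cycle. -/
theorem boundaries_le_cycles (R : Type*) [CommRing R] (K : PreAbstractSimplicialComplex ι)
    (p : ℕ) : boundaries R K p ≤ cycles R K p := by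
  rintro _ ⟨c, hc, rfl⟩
  exact ⟨boundary_mem_chains K hc, boundary_boundary K hc⟩

/-- The reduced simplicial homology `H̃_p(K; R)`, for `p ≥ 0`. -/
abbrev ReducedHomology (R : Type*) [CommRing R] (K : PreAbstractSimplicialComplex ι) (p : ℕ) :
    Type _ :=
  Subquotient (cycles R K p) (boundaries R K p)

variable {G : Type*} [Group G] [MulAction G ι]

/-- The action of `G` on the vertices is an action by simplicial automorphisms of `K`. -/
def IsInvariant (G : Type*) [Group G] {ι : Type*} [MulAction G ι]
    (K : PreAbstractSimplicialComplex ι) : Prop :=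
  ∀ (g : G), ∀ s ∈ K.faces, s.map (MulAction.toPerm g).toEmbedding ∈ K.faces

/-- The representation on finitely supported functions on tuples that sends the basis element `v`
to `g • v`. -/
noncomputable def tupleRep (R : Type*) [CommRing R] (G : Type*) [Group G] (ι : Type*)
    [MulAction G ι] (p : ℕ) : Representation R G ((Fin p → ι) →₀ R) where
  toFun g := Finsupp.lmapDomain R R (fun v : Fin p → ι => g • v)
  map_one' := by ext; simp
  map_mul' g h := by ext; simp [mul_smul]

theorem boundary_tupleRep (R : Type*) [CommRing R] (p : ℕ) (g : G) (c : (Fin (p + 1) → ι) →₀ R) :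
    boundary R ι p (tupleRep R G ι (p + 1) g c) = tupleRep R G ι p g (boundary R ι p c) := by
  simp only [boundary, tupleRep, MonoidHom.coe_mk, OneHom.coe_mk, Finsupp.lmapDomain_apply,
    ← Finsupp.mapDomain_comp]
  rfl

theorem tupleRep_apply (R : Type*) [CommRing R] (p : ℕ) (g : G) (c : (Fin p → ι) →₀ R)
    (v : Fin p → ι) : tupleRep R G ι p g c v = c (g⁻¹ • v) := by
  have h := Finsupp.mapDomain_apply (MulAction.injective g) c (g⁻¹ • v)
  simpa [tupleRep] using h

theorem tupleRep_mem_chains (R : Type*) [CommRing R] {K : PreAbstractSimplicialComplex ι}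
    (hK : IsInvariant G K) (p : ℕ) (g : G) {c : (Fin p → ι) →₀ R} (hc : c ∈ chains R K p) :
    tupleRep R G ι p g c ∈ chains R K p := by
  obtain ⟨h1, h2⟩ := hc
  refine ⟨fun v hv => ?_, fun π v => ?_⟩
  · rw [tupleRep_apply] at hv
    obtain ⟨hinj, hf⟩ := h1 _ hv
    refine ⟨fun i j hij => hinj (by simp [hij]), hf.imp_right ?_⟩
    rintro ⟨s, hs, hsv⟩
    refine ⟨_, hK g s hs, ?_⟩
    rw [Finset.coe_map, hsv, ← Set.range_comp]
    congr 1
    funext i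
    simp
  · rw [tupleRep_apply, tupleRep_apply, ← h2]
    rfl

theorem cycles_le_comap (R : Type*) [CommRing R] {K : PreAbstractSimplicialComplex ι}
    (hK : IsInvariant G K) (p : ℕ) (g : G) :
    cycles R K p ≤ (cycles R K p).comap (tupleRep R G ι (p + 1) g) := by
  rintro c ⟨hc, hc'⟩
  refine ⟨tupleRep_mem_chains R hK _ g hc, ?_⟩
  rw [SetLike.mem_coe, LinearMap.mem_ker] at hc' ⊢
  rw [boundary_tupleRep, hc', map_zero]

theorem boundaries_le_comap (R : Type*) [CommRing R] {K : PreAbstractSimplicialComplex ι}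
    (hK : IsInvariant G K) (p : ℕ) (g : G) :
    boundaries R K p ≤ (boundaries R K p).comap (tupleRep R G ι (p + 1) g) := by
  rintro _ ⟨c, hc, rfl⟩
  exact ⟨tupleRep R G ι (p + 2) g c, tupleRep_mem_chains R hK _ g hc, boundary_tupleRep R _ g c⟩

/-- The representation of `G` on the reduced homology `H̃_p(K; R)` of a `G`-invariant complex. -/
noncomputable def homologyRep (R : Type*) [CommRing R] {K : PreAbstractSimplicialComplex ι}
    (hK : IsInvariant G K) (p : ℕ) : Representation R G (ReducedHomology R K p) :=
  subquotientRep (tupleRep R G ι (p + 1)) (cycles R K p) (boundaries R K p)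
    (cycles_le_comap R hK p) (boundaries_le_comap R hK p)

end SimplicialHomology

/-! ### The complex of trees -/

/-- A finite rooted tree with leaves labelled by `Fin n` (in place of `1, …, n`): the leaves are
the vertices of degree `1`, the root has degree at least `2`, and all other vertices have degree at
least `3`. -/
structure LabelledTree (n : ℕ) where
  V : Type
  finite : Finite V
  graph : SimpleGraph V
  isTree : graph.IsTree
  root : V
  leaf : Fin n → V
  leaf_injective : Function.Injective leaf
  mem_range_leaf_iff : ∀ v, v ∈ Set.range leaf ↔ (graph.neighborSet v).ncard = 1
  two_le_degree_root : 2 ≤ (graph.neighborSet root).ncard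
  three_le_degree : ∀ v, v ≠ root → v ∉ Set.range leaf → 3 ≤ (graph.neighborSet v).ncard

namespace LabelledTree

variable {n : ℕ}

/-- The root has degree `2` and all internal vertices have degree `3`. -/
def IsBinary (T : LabelledTree n) : Prop :=
  (T.graph.neighborSet T.root).ncard = 2 ∧
    ∀ v, v ≠ T.root → v ∉ Set.range T.leaf → (T.graph.neighborSet v).ncard = 3

/-- The internal edges: those not adjacent to a leaf. -/
def internalEdges (T : LabelledTree n) : Set (Sym2 T.V) :=
  {e ∈ T.graph.edgeSet | ∀ v ∈ e, v ∉ Set.range T.leaf}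

/-- Two rooted labelled trees are of the same combinatorial type if there is a root- and
label-preserving isomorphism between them. -/
def IsIso (T T' : LabelledTree n) : Prop :=
  ∃ φ : T.graph ≃g T'.graph, φ T.root = T'.root ∧ ∀ i, φ (T.leaf i) = T'.leaf i

theorem isIso_equivalence : Equivalence (IsIso (n := n)) where
  refl T := ⟨SimpleGraph.Iso.refl, rfl, fun _ => rfl⟩
  symm := by
    rintro T T' ⟨φ, h, h'⟩
    exact ⟨φ.symm, by rw [← h]; simp, fun i => by rw [← h' i]; simp⟩
  trans := by
    rintro T T' T'' ⟨φ, h, h'⟩ ⟨ψ, k, k'⟩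
    refine ⟨ψ.comp φ, ?_, fun i => ?_⟩
    · change ψ (φ T.root) = _
      rw [h, k]
    · change ψ (φ (T.leaf i)) = _
      rw [h', k']

instance setoid (n : ℕ) : Setoid (LabelledTree n) := ⟨IsIso, isIso_equivalence⟩

/-- `T'` is obtained from `T` by contracting the edges in the set `E`, via the quotient map `f`
that identifies precisely the vertices that are connected by edges in `E`. -/
def IsContraction (T : LabelledTree n) (E : Set (Sym2 T.V)) (T' : LabelledTree n) : Prop :=
  ∃ f : T.V → T'.V, Function.Surjective f ∧
    (∀ x y, f x = f y ↔ (SimpleGraph.fromEdgeSet E).Reachable x y) ∧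
    (∀ a b, T'.graph.Adj a b ↔ a ≠ b ∧ ∃ x y, f x = a ∧ f y = b ∧ T.graph.Adj x y) ∧
    f T.root = T'.root ∧ ∀ i, f (T.leaf i) = T'.leaf i

/-- Permuting the labels: the leaf labelled `i` in `T` is labelled `g i` in `T.relabel g`. -/
def relabel (g : Equiv.Perm (Fin n)) (T : LabelledTree n) : LabelledTree n where
  V := T.V
  finite := T.finite
  graph := T.graph
  isTree := T.isTree
  root := T.root
  leaf := T.leaf ∘ g.symm
  leaf_injective := T.leaf_injective.comp g.symm.injective
  mem_range_leaf_iff := by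
    rw [g.symm.surjective.range_comp]
    exact T.mem_range_leaf_iff
  two_le_degree_root := T.two_le_degree_root
  three_le_degree := by
    rw [g.symm.surjective.range_comp]
    exact T.three_le_degree

end LabelledTree

/-- Combinatorial types of rooted trees with `n` labelled leaves. -/
def TreeType (n : ℕ) : Type 1 := Quotient (LabelledTree.setoid n)

namespace LabelledTree

variable {n : ℕ}

/-- The combinatorial type of a tree. -/
def type (T : LabelledTree n) : TreeType n := Quotient.mk _ T

/-- The trees with a single internal edge obtained from `T` by contracting all internal edges but
one: the vertices of the simplex given by `T`. -/
def vertexSet (T : LabelledTree n) : Set (TreeType n) :=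
  {t | ∃ e ∈ T.internalEdges, ∃ T' : LabelledTree n,
    T.IsContraction (T.internalEdges \ {e}) T' ∧ t = T'.type}

theorem relabel_isIso (g : Equiv.Perm (Fin n)) {T T' : LabelledTree n} (h : IsIso T T') :
    IsIso (T.relabel g) (T'.relabel g) := by
  obtain ⟨φ, h, h'⟩ := h
  exact ⟨φ, h, fun i => h' (g.symm i)⟩

theorem internalEdges_relabel (g : Equiv.Perm (Fin n)) (T : LabelledTree n) :
    (T.relabel g).internalEdges = T.internalEdges := by
  have : Set.range (T.relabel g).leaf = Set.range T.leaf := g.symm.surjective.range_comp _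
  unfold internalEdges
  rw [this]
  rfl

end LabelledTree

/-- The symmetric group acts on combinatorial types of trees by permuting the labels. -/
instance TreeType.mulAction (n : ℕ) : MulAction (Equiv.Perm (Fin n)) (TreeType n) where
  smul g := Quotient.map (LabelledTree.relabel g) fun _ _ h => LabelledTree.relabel_isIso g h
  one_smul t := by
    induction t using Quotient.inductionOn
    rfl
  mul_smul g h t := by
    induction t using Quotient.inductionOn
    rfl

/-- The complex of trees `T_n`: the simplicial complex whose maximal simplices are given by the
combinatorial types of binary trees `B`. The face of `B` on the vertices coming from a nonempty set
`F` of internal edges stands for the tree obtained from `B` by contracting the internal edges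
outside `F`. -/
def treeComplex (n : ℕ) : PreAbstractSimplicialComplex (TreeType n) where
  faces := {s | s.Nonempty ∧ ∃ B : LabelledTree n, B.IsBinary ∧ (s : Set (TreeType n)) ⊆ B.vertexSet}
  isRelLowerSet_faces := by
    rintro s ⟨hs, B, hB, hsB⟩
    exact ⟨hs, fun t hts ht => ⟨ht, B, hB, (Finset.coe_subset.mpr hts).trans hsB⟩⟩

theorem treeComplex_isInvariant (n : ℕ) :
    SimplicialHomology.IsInvariant (Equiv.Perm (Fin n)) (treeComplex n) := by
  rintro g s ⟨hs, B, hB, hsB⟩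
  refine ⟨hs.map, B.relabel g, ?_, ?_⟩
  · refine ⟨hB.1, ?_⟩
    have : Set.range (B.relabel g).leaf = Set.range B.leaf := g.symm.surjective.range_comp _
    rw [this]
    exact hB.2
  · rw [Finset.coe_map]
    rintro _ ⟨t, ht, rfl⟩
    obtain ⟨e, he, T', ⟨f, h1, h2, h3, h4, h5⟩, rfl⟩ := hsB ht
    refine ⟨e, by rw [LabelledTree.internalEdges_relabel]; exact he, T'.relabel g, ?_, rfl⟩
    rw [LabelledTree.internalEdges_relabel]
    exact ⟨f, h1, h2, h3, h4, fun i => h5 (g.symm i)⟩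

/-! ### The order complex of the partition lattice -/

/-- The order complex of the proper part `L \ {⊥, ⊤}` of a bounded poset: the nonempty finite
chains. -/
def orderComplex (L : Type*) [PartialOrder L] [BoundedOrder L] : PreAbstractSimplicialComplex L where
  faces := {s | s.Nonempty ∧ IsChain (· ≤ ·) (s : Set L) ∧ ⊥ ∉ s ∧ ⊤ ∉ s}
  isRelLowerSet_faces := by
    rintro s ⟨hs, hc, hb, ht⟩
    exact ⟨hs, fun t hts htn =>
      ⟨htn, hc.mono (Finset.coe_subset.mpr hts), fun h => hb (hts h), fun h => ht (hts h)⟩⟩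

/-- The partition lattice `Π_n`, as the lattice of equivalence relations on `Fin n`. The bottom
element is the partition into singletons, the top element the partition with a single block. -/
abbrev PartitionLattice (n : ℕ) : Type := Setoid (Fin n)

/-- The symmetric group acts on the partition lattice by applying a permutation to the elements of
the blocks: `g i` and `g j` are in one block of `g • r` iff `i` and `j` are in one block of `r`. -/
instance PartitionLattice.mulAction (n : ℕ) :
    MulAction (Equiv.Perm (Fin n)) (PartitionLattice n) where
  smul g r := r.comap g.symm
  one_smul _ := rfl
  mul_smul _ _ _ := rfl

theorem PartitionLattice.smul_rel {n : ℕ} (g : Equiv.Perm (Fin n)) (r : PartitionLattice n)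
    (i j : Fin n) : (g • r) (g i) (g j) ↔ r i j := by
  change r (g.symm (g i)) (g.symm (g j)) ↔ r i j
  simp

theorem PartitionLattice.smul_mono {n : ℕ} (g : Equiv.Perm (Fin n)) {r s : PartitionLattice n}
    (h : r ≤ s) : g • r ≤ g • s :=
  fun _ _ hxy => h hxy

theorem orderComplex_partitionLattice_isInvariant (n : ℕ) :
    SimplicialHomology.IsInvariant (Equiv.Perm (Fin n)) (orderComplex (PartitionLattice n)) := by
  rintro g s ⟨hs, hc, hb, ht⟩
  refine ⟨hs.map, ?_, ?_, ?_⟩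
  · rw [Finset.coe_map]
    rintro _ ⟨a, ha, rfl⟩ _ ⟨b, hb, rfl⟩ hab
    exact (hc ha hb (fun h => hab (by rw [h]))).imp
      (PartitionLattice.smul_mono g) (PartitionLattice.smul_mono g)
  · intro h
    obtain ⟨a, ha, hab⟩ := Finset.mem_map.mp h
    have h' : a ≤ ⊥ := by
      have h1 : g • a = ⊥ := hab
      have h2 : a = g⁻¹ • (⊥ : PartitionLattice n) := by rw [← h1, inv_smul_smul]
      have h3 := PartitionLattice.smul_mono g⁻¹ (bot_le : ⊥ ≤ g • (⊥ : PartitionLattice n))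
      rw [inv_smul_smul] at h3
      rwa [h2]
    exact hb ((le_bot_iff.mp h') ▸ ha)
  · intro h
    obtain ⟨a, ha, hab⟩ := Finset.mem_map.mp h
    have h' : ⊤ ≤ a := by
      have h1 : g • a = ⊤ := hab
      have h2 : a = g⁻¹ • (⊤ : PartitionLattice n) := by rw [← h1, inv_smul_smul]
      have h3 := PartitionLattice.smul_mono g⁻¹ (le_top : g • (⊤ : PartitionLattice n) ≤ ⊤)
      rw [inv_smul_smul] at h3
      rwa [h2]
    exact ht ((top_le_iff.mp h') ▸ ha)

/-! Record a tree with one internal edge by the set of labels below that edge: a proper subset of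
`Fin n` with at least two elements, called a cluster. Every internal edge of any tree yields a
cluster, and two clusters of one tree are nested or disjoint. Conversely a pairwise compatible
family extends to a maximal laminar family, in which every non-singleton splits into exactly two
parts, so it comes from a binary tree. Hence T_n is equivariantly the complex of compatible families
of clusters (`mem_treeComplex_faces_iff`).

List n - 2 compatible clusters in an order extending inclusion and merge them one after another.
This produces a maximal chain of proper partitions, and each maximal chain arises from exactly one
such list (`merge_injective`, `exists_merge_eq`). A top simplex of T_n thus corresponds to several
top simplices of the order complex, one for each admissible order. Neither complex has a simplex
with more than n - 2 vertices, so top homology is the module of cycles, and the isomorphism pairs c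
with d when c v = d (`merge` v) for all sorted v.

The cycle conditions have to match. Delete the partition in position k of the chain of v. If the
clusters in positions k and k + 1 are disjoint, the gap can be refilled in exactly two ways, which
differ by swapping the two clusters. The condition on d then says that d changes sign under the
swap; for c this is the alternation built into oriented chains. So every cycle d is alternating in
the order of the clusters and comes from a chain c (`apply_merge_swap`, `apply_merge_comp_perm`). If
the cluster in position k is contained in the next one, or k is last, refillings by partitions
correspond to compatible replacements of that cluster, and the conditions on c and d coincide
(`sum_update_of_nestedAt`). These positions suffice for c, because every vertex of a simplex of
clusters can be sorted into one (`exists_sorted_nestedAt`). -/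

namespace SimplicialHomology

/-- An equivariant isomorphism of cycles that matches the boundaries induces an isomorphism of
representations on the subquotients. -/
theorem subquotientRep_equiv {R M M' G : Type*} [CommRing R] [AddCommGroup M] [Module R M]
    [AddCommGroup M'] [Module R M'] [Group G] {ρ : Representation R G M}
    {ρ' : Representation R G M'} {Z B : Submodule R M} {Z' B' : Submodule R M'}
    (hZ : ∀ g, Z ≤ Z.comap (ρ g)) (hB : ∀ g, B ≤ B.comap (ρ g))
    (hZ' : ∀ g, Z' ≤ Z'.comap (ρ' g)) (hB' : ∀ g, B' ≤ B'.comap (ρ' g))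
    (e : Z ≃ₗ[R] Z') (heB : ∀ z : Z, (z : M) ∈ B ↔ (e z : M') ∈ B')
    (he : ∀ (g : G) (z : Z), (e ⟨ρ g z, hZ g z.2⟩ : M') = ρ' g (e z)) :
    Nonempty ((subquotientRep ρ Z B hZ hB).Equiv (subquotientRep ρ' Z' B' hZ' hB')) := by
  have hmap : (B.submoduleOf Z).map (e : Z →ₗ[R] Z') = B'.submoduleOf Z' := by
    ext y
    simp only [Submodule.mem_map]
    constructor
    · rintro ⟨x, hx, rfl⟩
      exact (heB x).1 hx
    · intro hy
      refine ⟨e.symm y, (heB _).2 ?_, by simp⟩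
      rw [LinearEquiv.apply_symm_apply]
      exact hy
  refine ⟨Representation.Equiv.mk (Submodule.Quotient.equiv _ _ e hmap) fun g => ?_⟩
  refine LinearMap.ext fun x => ?_
  obtain ⟨z, rfl⟩ := Submodule.Quotient.mk_surjective _ x
  change Submodule.Quotient.mk (e ⟨ρ g z, hZ g z.2⟩) =
    Submodule.Quotient.mk (p := B'.submoduleOf Z') ⟨ρ' g (e z), hZ' g (e z).2⟩
  congr 1
  exact Subtype.ext (he g z)

/-! ### Homology under an embedding of vertex sets -/

section Transport

variable {ι κ : Type*} {R : Type*} [CommRing R]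

theorem isFaceTuple_comp_iff (τ : ι ↪ κ) {K : PreAbstractSimplicialComplex ι}
    {K' : PreAbstractSimplicialComplex κ}
    (hK : ∀ t, t ∈ K'.faces ↔ ∃ s ∈ K.faces, t = s.map τ) {p : ℕ} (v : Fin p → ι) :
    IsFaceTuple K' (τ ∘ v) ↔ IsFaceTuple K v := by
  unfold IsFaceTuple
  rw [τ.injective.of_comp_iff]
  refine and_congr_right fun _ => or_congr_right ?_
  constructor
  · rintro ⟨t, ht, htv⟩
    obtain ⟨s, hs, rfl⟩ := (hK t).1 ht
    refine ⟨s, hs, ?_⟩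
    rw [Finset.coe_map, Set.range_comp] at htv
    exact Set.image_injective.2 τ.injective htv
  · rintro ⟨s, hs, hsv⟩
    exact ⟨_, (hK _).2 ⟨s, hs, rfl⟩, by rw [Finset.coe_map, Set.range_comp, hsv]⟩

theorem exists_eq_comp_of_isFaceTuple (τ : ι ↪ κ) {K : PreAbstractSimplicialComplex ι}
    {K' : PreAbstractSimplicialComplex κ}
    (hK : ∀ t, t ∈ K'.faces ↔ ∃ s ∈ K.faces, t = s.map τ) {p : ℕ} {w : Fin p → κ}
    (hw : IsFaceTuple K' w) : ∃ v, w = τ ∘ v := by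
  rcases hw.2 with rfl | ⟨t, ht, htw⟩
  · exact ⟨Fin.elim0, Subsingleton.elim _ _⟩
  · obtain ⟨s, hs, rfl⟩ := (hK t).1 ht
    have : ∀ j, ∃ x, τ x = w j := fun j => by
      have : w j ∈ ((s.map τ : Finset κ) : Set κ) := htw ▸ ⟨j, rfl⟩
      rw [Finset.coe_map] at this
      obtain ⟨x, -, hx⟩ := this
      exact ⟨x, hx⟩
    choose v hv using this
    exact ⟨v, funext fun j => (hv j).symm⟩

theorem mapDomain_mem_chains_iff (τ : ι ↪ κ) {K : PreAbstractSimplicialComplex ι}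
    {K' : PreAbstractSimplicialComplex κ}
    (hK : ∀ t, t ∈ K'.faces ↔ ∃ s ∈ K.faces, t = s.map τ) {p : ℕ} (c : (Fin p → ι) →₀ R) :
    Finsupp.mapDomain (fun v => τ ∘ v) c ∈ chains R K' p ↔ c ∈ chains R K p := by
  have hinj : Function.Injective fun v : Fin p → ι => τ ∘ v := τ.injective.comp_left
  have happ : ∀ v, Finsupp.mapDomain (fun v => τ ∘ v) c (τ ∘ v) = c v :=
    fun v => Finsupp.mapDomain_apply hinj c v
  constructor
  · rintro ⟨h1, h2⟩
    refine ⟨fun v hv => (isFaceTuple_comp_iff τ hK v).1 (h1 _ (by rwa [happ])), fun π v => ?_⟩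
    rw [← happ, ← happ v, ← h2]
    rfl
  · rintro ⟨h1, h2⟩
    refine ⟨fun w hw => ?_, fun π w => ?_⟩
    · by_cases hr : w ∈ Set.range fun v : Fin p → ι => τ ∘ v
      · obtain ⟨v, rfl⟩ := hr
        exact (isFaceTuple_comp_iff τ hK v).2 (h1 v (by rwa [← happ]))
      · exact absurd (Finsupp.mapDomain_of_notMem_range _ _ hr) hw
    · by_cases hr : w ∈ Set.range fun v : Fin p → ι => τ ∘ v
      · obtain ⟨v, rfl⟩ := hr
        simp only [happ, ← h2 π]
        exact happ (v ∘ π)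
      -- The image of the tuples is stable under reordering in both directions, so both sides vanish
      -- off it.
      · rw [Finsupp.mapDomain_of_notMem_range _ _ hr, Finsupp.mapDomain_of_notMem_range, smul_zero]
        rintro ⟨v, hv⟩
        refine hr ⟨v ∘ π.symm, ?_⟩
        funext j
        have := congrFun hv (π.symm j)
        simpa using this

theorem exists_mapDomain_eq (τ : ι ↪ κ) {K : PreAbstractSimplicialComplex ι}
    {K' : PreAbstractSimplicialComplex κ}
    (hK : ∀ t, t ∈ K'.faces ↔ ∃ s ∈ K.faces, t = s.map τ) {p : ℕ} {c' : (Fin p → κ) →₀ R}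
    (hc' : c' ∈ chains R K' p) : ∃ c, Finsupp.mapDomain (fun v => τ ∘ v) c = c' := by
  have hinj : Function.Injective fun v : Fin p → ι => τ ∘ v := τ.injective.comp_left
  refine ⟨c'.comapDomain _ hinj.injOn, Finsupp.mapDomain_comapDomain _ hinj _ fun w hw => ?_⟩
  obtain ⟨v, rfl⟩ := exists_eq_comp_of_isFaceTuple τ hK (hc'.1 w (Finsupp.mem_support_iff.1 hw))
  exact ⟨v, rfl⟩

theorem boundary_mapDomain (τ : ι → κ) {p : ℕ} (c : (Fin (p + 1) → ι) →₀ R) :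
    boundary R κ p (Finsupp.mapDomain (fun v => τ ∘ v) c) =
      Finsupp.mapDomain (fun v => τ ∘ v) (boundary R ι p c) := by
  simp only [boundary, Finsupp.lmapDomain_apply, ← Finsupp.mapDomain_comp]
  rfl

/-- An equivariant injection of the vertices that carries one complex to another induces an
isomorphism on homology. -/
theorem homologyRep_equiv_of_embedding {G : Type*} [Group G] [MulAction G ι] [MulAction G κ]
    (τ : ι ↪ κ) (hτ : ∀ (g : G) x, τ (g • x) = g • τ x) {K : PreAbstractSimplicialComplex ι}
    {K' : PreAbstractSimplicialComplex κ} (hK : ∀ t, t ∈ K'.faces ↔ ∃ s ∈ K.faces, t = s.map τ)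
    (hG : IsInvariant G K) (hG' : IsInvariant G K') (p : ℕ) :
    Nonempty ((homologyRep R hG p).Equiv (homologyRep R hG' p)) := by
  have hinj : ∀ m, Function.Injective
      (Finsupp.mapDomain (M := R) fun v : Fin m → ι => τ ∘ v) :=
    fun m => Finsupp.mapDomain_injective τ.injective.comp_left
  set F : ((Fin (p + 1) → ι) →₀ R) →ₗ[R] ((Fin (p + 1) → κ) →₀ R) :=
    Finsupp.lmapDomain R R fun v => τ ∘ v
  have hcyc : ∀ c, F c ∈ cycles R K' p ↔ c ∈ cycles R K p := fun c => by
    refine and_congr (mapDomain_mem_chains_iff τ hK c) ?_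
    change boundary R κ p (Finsupp.mapDomain (fun v => τ ∘ v) c) = 0 ↔ boundary R ι p c = 0
    rw [boundary_mapDomain]
    exact ⟨fun h => hinj _ (by rw [h, Finsupp.mapDomain_zero]), fun h => by
      rw [h, Finsupp.mapDomain_zero]⟩
  have hbd : ∀ c, F c ∈ boundaries R K' p ↔ c ∈ boundaries R K p := fun c => by
    constructor
    · rintro ⟨b', hb', hbc⟩
      obtain ⟨b, rfl⟩ := exists_mapDomain_eq τ hK hb'
      refine ⟨b, (mapDomain_mem_chains_iff τ hK b).1 hb', hinj _ ?_⟩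
      rw [← boundary_mapDomain]
      exact hbc
    · rintro ⟨b, hb, rfl⟩
      exact ⟨_, (mapDomain_mem_chains_iff τ hK b).2 hb, boundary_mapDomain τ b⟩
  let e₀ : cycles R K p →ₗ[R] cycles R K' p := F.restrict fun c hc => (hcyc c).2 hc
  have he₀ : Function.Bijective e₀ := by
    refine ⟨fun a b hab => Subtype.ext (hinj _ (congrArg Subtype.val hab)), fun b => ?_⟩
    obtain ⟨c, hc⟩ := exists_mapDomain_eq τ hK b.2.1
    exact ⟨⟨c, (hcyc c).1 (by rw [show F c = b from hc]; exact b.2)⟩, Subtype.ext hc⟩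
  refine subquotientRep_equiv _ _ _ _ (LinearEquiv.ofBijective e₀ he₀) (fun z => (hbd z).symm)
    fun g z => ?_
  change Finsupp.mapDomain _ (Finsupp.mapDomain _ _) = Finsupp.mapDomain _ (Finsupp.mapDomain _ _)
  rw [← Finsupp.mapDomain_comp, ← Finsupp.mapDomain_comp]
  congr 1
  funext v j
  exact hτ g (v j)

end Transport

/-! ### Chains and cycles in terms of sorted tuples -/

variable {ι : Type*} {R : Type*} [CommRing R] {K : PreAbstractSimplicialComplex ι}

theorem chains_apply_comp {p : ℕ} {c : (Fin p → ι) →₀ R} (hc : c ∈ chains R K p)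
    (σ : Equiv.Perm (Fin p)) (v : Fin p → ι) :
    c (v ∘ σ) = ((Equiv.Perm.sign σ : ℤˣ) : ℤ) • c v :=
  hc.2 σ v

theorem smul_sign_eq_zero_iff {p : ℕ} (σ : Equiv.Perm (Fin p)) (r : R) :
    ((Equiv.Perm.sign σ : ℤˣ) : ℤ) • r = 0 ↔ r = 0 := by
  rcases Int.units_eq_one_or (Equiv.Perm.sign σ) with h | h <;> simp [h]

theorem IsFaceTuple.comp {p : ℕ} {v : Fin p → ι} (hv : IsFaceTuple K v)
    (σ : Equiv.Perm (Fin p)) : IsFaceTuple K (v ∘ σ) :=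
  ⟨hv.1.comp σ.injective, by rw [σ.surjective.range_comp]; exact hv.2⟩

/-- A chain is determined by its values on sorted tuples. -/
theorem chains_eq_of_sorted {p : ℕ} {c d : (Fin p → ι) →₀ R} (hc : c ∈ chains R K p)
    (hd : d ∈ chains R K p) (S : (Fin p → ι) → Prop)
    (hS : ∀ v, IsFaceTuple K v → ∃ σ : Equiv.Perm (Fin p), S (v ∘ σ))
    (h : ∀ v, S v → c v = d v) : c = d := by
  have h0 : ∀ v, S v → (c - d) v = 0 := fun v hv => by simp [h v hv]
  have hcd := (chains R K p).sub_mem hc hd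
  rw [← sub_eq_zero]
  ext v
  by_contra hv
  obtain ⟨σ, hσ⟩ := hS v (hcd.1 v hv)
  have := h0 _ hσ
  rw [chains_apply_comp hcd, smul_sign_eq_zero_iff] at this
  exact hv this

section Finite

variable [Fintype ι]

theorem boundary_apply_eq_sum {p : ℕ} (c : (Fin (p + 1) → ι) →₀ R) (w : Fin p → ι) :
    boundary R ι p c w = ∑ x, c (Fin.cons x w) := by
  classical
  rw [boundary_apply, Finsupp.sum_fintype _ _ (by simp),
    ← (Fin.consEquiv fun _ : Fin (p + 1) => ι).sum_comp, Fintype.sum_prod_type]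
  refine Finset.sum_congr rfl fun x _ => ?_
  simp [Fin.consEquiv]

/-- A chain is a cycle iff the boundary condition holds at one representative of every simplex
with a marked vertex. -/
theorem boundary_eq_zero_iff {p : ℕ} {c : (Fin (p + 1) → ι) →₀ R} (hc : c ∈ chains R K (p + 1))
    (S : (Fin (p + 1) → ι) → Fin (p + 1) → Prop)
    (hS : ∀ v, IsFaceTuple K v → ∃ σ : Equiv.Perm (Fin (p + 1)), S (v ∘ σ) (σ.symm 0)) :
    boundary R ι p c = 0 ↔ ∀ v k, S v k → ∑ x, c (Function.update v k x) = 0 := by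
  -- `boundary` sums over the entry in position 0, whereas the condition to be reached varies the
  -- entry in position k. A permutation taking k to 0 converts one into the other at the cost of a
  -- sign independent of x.
  have key : ∀ (v : Fin (p + 1) → ι) (k : Fin (p + 1)) (σ : Equiv.Perm (Fin (p + 1))) (x : ι),
      σ k = 0 → Function.update (v ∘ σ) k x = (Fin.cons x (Fin.tail v) : Fin (p + 1) → ι) ∘ σ := by
    intro v k σ x h
    funext i
    by_cases hi : i = k
    · subst hi
      simp [h]
    · have hne : σ i ≠ 0 := fun h' => hi (σ.injective (h'.trans h.symm))
      obtain ⟨j, hj⟩ := Fin.exists_succ_eq.2 hne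
      simp [hi, ← hj, Fin.tail]
  constructor
  · intro h v k _
    set σ := Equiv.swap 0 k
    have hv : v = (v ∘ σ) ∘ σ := by funext i; simp [σ]
    have := DFunLike.congr_fun h (Fin.tail (v ∘ σ))
    rw [boundary_apply_eq_sum] at this
    rw [hv, Finset.sum_congr rfl fun x _ => by
      rw [key (v ∘ σ) k σ x (by simp [σ]), chains_apply_comp hc σ], ← Finset.smul_sum, this, Finsupp.zero_apply, smul_zero]
  · intro h
    ext w
    rw [boundary_apply_eq_sum, Finsupp.zero_apply]
    by_cases hw : ∃ x, c (Fin.cons x w) ≠ 0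
    · obtain ⟨x, hx⟩ := hw
      obtain ⟨σ, hσ⟩ := hS _ (hc.1 _ hx)
      have := h _ _ hσ
      rw [Finset.sum_congr rfl fun x _ => by
        rw [key _ _ σ x (by simp), chains_apply_comp hc σ], ← Finset.smul_sum,
        Fin.tail_cons] at this
      exact (smul_sign_eq_zero_iff σ _).1 this
    · push Not at hw
      exact Finset.sum_eq_zero fun x _ => hw x

/-- A function on sorted tuples that is alternating as far as this makes sense extends to a
chain. -/
theorem exists_chain_of_sorted {p : ℕ} (S : (Fin p → ι) → Prop)
    (hS : ∀ v, IsFaceTuple K v → ∃ σ : Equiv.Perm (Fin p), S (v ∘ σ))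
    (hSK : ∀ v, S v → IsFaceTuple K v) (f : (Fin p → ι) → R)
    (hf : ∀ v (σ : Equiv.Perm (Fin p)), S v → S (v ∘ σ) →
      f (v ∘ σ) = ((Equiv.Perm.sign σ : ℤˣ) : ℤ) • f v) :
    ∃ c ∈ chains R K p, ∀ v, S v → c v = f v := by
  classical
  choose! s hs using hS
  set F : (Fin p → ι) → R := fun v =>
    if IsFaceTuple K v then ((Equiv.Perm.sign (s v) : ℤˣ) : ℤ) • f (v ∘ s v) else 0 with hF
  -- The value does not depend on the chosen sorting `s v`: two sortings of v differ by a
  -- permutation between sorted tuples, to which `hf` applies.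
  have hsort : ∀ v (σ : Equiv.Perm (Fin p)), IsFaceTuple K v → S (v ∘ σ) →
      F v = ((Equiv.Perm.sign σ : ℤˣ) : ℤ) • f (v ∘ σ) := by
    intro v σ hv hσ
    have h1 := hf (v ∘ s v) ((s v).symm * σ) (hs v hv)
    have h2 : (v ∘ s v) ∘ ((s v).symm * σ : Equiv.Perm (Fin p)) = v ∘ σ := by
      funext i; simp
    rw [h2] at h1
    rw [hF]
    simp only [if_pos hv]
    rw [h1 hσ, smul_smul]
    congr 1
    simp only [Equiv.Perm.sign_mul, Equiv.Perm.sign_symm, Units.val_mul]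
    rcases Int.units_eq_one_or (Equiv.Perm.sign σ) with h | h <;> simp [h]
  refine ⟨Finsupp.equivFunOnFinite.symm F, ⟨fun v hv => ?_, fun π v => ?_⟩, fun v hv => ?_⟩
  · by_contra h
    exact hv (by simp [hF, h])
  · simp only [Finsupp.equivFunOnFinite_symm_apply_apply]
    by_cases hv : IsFaceTuple K v
    · have h1 := hs v hv
      have h2 : (v ∘ π) ∘ (π.symm * s v : Equiv.Perm (Fin p)) = v ∘ s v := by
        funext i; simp
      rw [hsort (v ∘ π) (π.symm * s v) (hv.comp π) (by rwa [h2]), h2, hsort v (s v) hv h1,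
        smul_smul]
      simp
    · have : ¬ IsFaceTuple K (v ∘ π) := fun h => hv (by
        have := h.comp π.symm
        rwa [Function.comp_assoc, Equiv.self_comp_symm, Function.comp_id] at this)
      simp [hF, hv, this]
  · have := hsort v 1 (hSK v hv) hv
    simpa using this

end Finite

end SimplicialHomology

/-! ### Clusters and the chains of partitions obtained by merging them -/

/-- A proper subset of `Fin n` with at least two elements. -/
def Cluster (n : ℕ) : Type := {S : Set (Fin n) // S.Nontrivial ∧ S ≠ Set.univ}

namespace Cluster

variable {n : ℕ}

instance : SetLike (Cluster n) (Fin n) := ⟨Subtype.val, Subtype.val_injective⟩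

theorem nontrivial (S : Cluster n) : (S : Set (Fin n)).Nontrivial := S.2.1

theorem ne_univ (S : Cluster n) : (S : Set (Fin n)) ≠ Set.univ := S.2.2

theorem nonempty (S : Cluster n) : (S : Set (Fin n)).Nonempty := S.nontrivial.nonempty

noncomputable instance : Fintype (Cluster n) :=
  have : Finite (Cluster n) := Subtype.finite
  Fintype.ofFinite _

/-- Two clusters are compatible if they are nested or disjoint. -/
def Compatible (S S' : Cluster n) : Prop :=
  (S : Set (Fin n)) ⊆ S' ∨ (S' : Set (Fin n)) ⊆ S ∨ Disjoint (S : Set (Fin n)) S'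

theorem Compatible.symm {S S' : Cluster n} (h : Compatible S S') : Compatible S' S := by
  rcases h with h | h | h
  exacts [Or.inr (Or.inl h), Or.inl h, Or.inr (Or.inr h.symm)]

/-- Pairwise compatible clusters, listed in an order that extends inclusion. -/
def Sorted {p : ℕ} (v : Fin p → Cluster n) : Prop :=
  ∀ i j, i < j → (v i : Set (Fin n)) ⊂ v j ∨ Disjoint (v i : Set (Fin n)) (v j)

variable {p : ℕ} {v : Fin p → Cluster n}

theorem Sorted.ssubset_of_mem (hv : Sorted v) {i j : Fin p} (hij : i < j) {x : Fin n}
    (hi : x ∈ v i) (hj : x ∈ v j) : (v i : Set (Fin n)) ⊂ v j :=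
  (hv i j hij).resolve_right fun h => Set.disjoint_left.1 h hi hj

theorem Sorted.subset_of_mem (hv : Sorted v) {i j : Fin p} (hij : i ≤ j) {x : Fin n}
    (hi : x ∈ v i) (hj : x ∈ v j) : (v i : Set (Fin n)) ⊆ v j := by
  rcases hij.eq_or_lt with rfl | h
  exacts [subset_rfl, (hv.ssubset_of_mem h hi hj).subset]

theorem Sorted.injective (hv : Sorted v) : Function.Injective v := by
  have key : ∀ i j, i < j → v i ≠ v j := by
    intro i j hij h
    obtain ⟨x, hx⟩ := (v i).nonempty
    exact (hv.ssubset_of_mem hij hx (h ▸ hx)).ne (by rw [h])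
  intro i j h
  by_contra hne
  rcases lt_or_gt_of_ne hne with h' | h'
  exacts [key _ _ h' h, key _ _ h' h.symm]

theorem Sorted.compatible (hv : Sorted v) (i j : Fin p) : Compatible (v i) (v j) := by
  rcases lt_trichotomy i j with h | rfl | h
  · exact (hv i j h).imp (fun h => h.subset) Or.inr
  · exact Or.inl subset_rfl
  · exact Compatible.symm ((hv j i h).imp (fun h => h.subset) Or.inr)

/-- The partitions obtained by successively merging the clusters `v 0`, `v 1`, …. -/
def merge (v : Fin p → Cluster n) (j : Fin p) : Setoid (Fin n) :=
  Relation.EqvGen.setoid fun x y => ∃ i ≤ j, x ∈ v i ∧ y ∈ v i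

/-- No transitive closure is needed: clusters that share an element are nested, so two overlapping
links are both contained in the later one. -/
theorem merge_iff (hv : Sorted v) {j : Fin p} {x y : Fin n} :
    merge v j x y ↔ x = y ∨ ∃ i ≤ j, x ∈ v i ∧ y ∈ v i := by
  constructor
  · intro h
    induction h with
    | rel x y h => exact Or.inr h
    | refl x => exact Or.inl rfl
    | symm x y _ ih =>
      exact ih.imp Eq.symm fun ⟨i, hi, h1, h2⟩ => ⟨i, hi, h2, h1⟩
    | trans x y z _ _ ih1 ih2 =>
      rcases ih1 with rfl | ⟨i, hi, h1, h2⟩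
      · exact ih2
      rcases ih2 with rfl | ⟨k, hk, h3, h4⟩
      · exact Or.inr ⟨i, hi, h1, h2⟩
      rcases le_total i k with h | h
      · exact Or.inr ⟨k, hk, hv.subset_of_mem h h2 h3 h1, h4⟩
      · exact Or.inr ⟨i, hi, h1, hv.subset_of_mem h h3 h2 h4⟩
  · rintro (rfl | h)
    · exact Setoid.refl' _ _
    · exact Relation.EqvGen.rel _ _ h

theorem merge_of_mem {i j : Fin p} (hij : i ≤ j) {x y : Fin n} (hx : x ∈ v i) (hy : y ∈ v i) :
    merge v j x y :=
  Relation.EqvGen.rel _ _ ⟨i, hij, hx, hy⟩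

/-- An earlier cluster meeting `v j` lies inside it, so `v j` is a full block at the moment it is
merged. -/
theorem merge_iff_of_mem (hv : Sorted v) {j : Fin p} {x y : Fin n} (hx : x ∈ v j) :
    merge v j x y ↔ y ∈ v j := by
  refine ⟨fun h => ?_, fun hy => merge_of_mem le_rfl hx hy⟩
  rcases (merge_iff hv).1 h with rfl | ⟨i, hi, h1, h2⟩
  exacts [hx, hv.subset_of_mem hi h1 hx h2]

theorem merge_mono {i j : Fin p} (hij : i ≤ j) : merge v i ≤ merge v j := by
  intro x y h
  induction h with
  | rel x y h =>
    obtain ⟨k, hk, h1, h2⟩ := h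
    exact merge_of_mem (hk.trans hij) h1 h2
  | refl x => exact Setoid.refl' _ _
  | symm x y _ ih => exact Setoid.symm' _ ih
  | trans x y z _ _ ih1 ih2 => exact Setoid.trans' _ ih1 ih2

/-- Each step joins something new. If some x in `v j` lies in an earlier cluster, the last such
cluster contains all the others through x and is a proper subset of `v j`; any y of `v j` outside it
works. If x lies in none, any other element works. -/
theorem Sorted.exists_split (hv : Sorted v) (j : Fin p) :
    ∃ x ∈ v j, ∃ y ∈ v j, x ≠ y ∧ ∀ i < j, ¬ merge v i x y := by
  have key : ∀ x y, x ≠ y → (∀ i < j, x ∈ v i → y ∉ v i) → ∀ i < j, ¬ merge v i x y := by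
    intro x y hxy h i hi hm
    rcases (merge_iff hv).1 hm with h' | ⟨k, hk, h1, h2⟩
    exacts [hxy h', h k (hk.trans_lt hi) h1 h2]
  obtain ⟨x, hx⟩ := (v j).nonempty
  by_cases hex : ∃ i < j, x ∈ v i
  · obtain ⟨i, ⟨hij, hxi⟩, hmax⟩ :=
      (Set.toFinite {i | i < j ∧ x ∈ v i}).exists_le_maximal (a := hex.choose) hex.choose_spec
        |>.imp fun _ h => h.2
    obtain ⟨y, hy, hyi⟩ := Set.exists_of_ssubset (hv.ssubset_of_mem hij hxi hx)
    have hxy : x ≠ y := fun h => hyi (h ▸ hxi)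
    refine ⟨x, hx, y, hy, hxy, key x y hxy fun k hk hxk hyk => hyi ?_⟩
    have hki : k ≤ i := by
      rcases le_total k i with h | h
      exacts [h, hmax ⟨hk, hxk⟩ h]
    exact hv.subset_of_mem hki hxk hxi hyk
  · push Not at hex
    obtain ⟨y, hy, hyx⟩ := (v j).nontrivial.exists_ne x
    exact ⟨x, hx, y, hy, hyx.symm, key x y hyx.symm fun i hi h => absurd h (hex i hi)⟩

/-- The cluster merged at step `j` consists of the elements that get a new partner. -/
theorem mem_iff_merge (hv : Sorted v) {j : Fin p} {x : Fin n} :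
    x ∈ v j ↔ ∃ y, x ≠ y ∧ merge v j x y ∧ ∀ i < j, ¬ merge v i x y := by
  constructor
  · intro hx
    obtain ⟨a, ha, b, hb, hne', hab⟩ := hv.exists_split j
    -- If x were joined before step j to every other element of `v j`, then a and b would be joined
    -- through x before step j, contrary to their choice.
    by_contra! hcon
    have hne : ∀ y ∈ v j, x ≠ y → ∃ i < j, merge v i x y :=
      fun y hy hxy => hcon y hxy (merge_of_mem le_rfl hx hy)
    by_cases hxa : x = a
    · subst hxa
      obtain ⟨i, hi, h1⟩ := hne b hb hne'
      exact hab i hi h1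
    · obtain ⟨i, hi, h1⟩ := hne a ha hxa
      by_cases hxb : x = b
      · subst hxb
        exact hab i hi (Setoid.symm' _ h1)
      · obtain ⟨k, hk, h2⟩ := hne b hb hxb
        exact hab (max i k) (max_lt hi hk) (Setoid.trans' _
          (Setoid.symm' _ (merge_mono (le_max_left i k) h1)) (merge_mono (le_max_right i k) h2))
  · rintro ⟨y, hxy, hy, h⟩
    rcases (merge_iff hv).1 hy with rfl | ⟨i, hi, h1, h2⟩
    · exact absurd rfl hxy
    · rcases hi.eq_or_lt with rfl | hi
      exacts [h1, absurd (merge_of_mem le_rfl h1 h2) (h i hi)]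

theorem merge_strictMono (hv : Sorted v) : StrictMono (merge v) := by
  intro i j hij
  refine lt_of_le_of_ne (merge_mono hij.le) fun h => ?_
  obtain ⟨x, hx, y, hy, -, hxy⟩ := hv.exists_split j
  exact hxy i hij (h ▸ merge_of_mem le_rfl hx hy)

theorem merge_ne_bot (j : Fin p) : merge v j ≠ ⊥ := by
  intro h
  obtain ⟨x, hx, y, hy, hxy⟩ := (v j).nontrivial
  have : merge v j x y := merge_of_mem le_rfl hx hy
  rw [h] at this
  exact hxy this

theorem merge_ne_top (hv : Sorted v) (j : Fin p) : merge v j ≠ ⊤ := by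
  intro h
  obtain ⟨x, hx⟩ := (v j).nonempty
  refine (v j).ne_univ (Set.eq_univ_of_forall fun y => (merge_iff_of_mem hv hx).1 ?_)
  rw [h]
  trivial

/-- By `mem_iff_merge` the clusters can be read off from the chain of partitions alone. -/
theorem merge_injective {v' : Fin p → Cluster n} (hv : Sorted v) (hv' : Sorted v')
    (h : merge v = merge v') : v = v' := by
  funext j
  refine SetLike.ext fun x => ?_
  rw [mem_iff_merge hv, mem_iff_merge hv', h]

end Cluster

/-! ### Maximal chains in the partition lattice -/

namespace PartitionLattice

variable {n : ℕ}

noncomputable instance : Fintype (PartitionLattice n) :=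
  have : Finite (PartitionLattice n) :=
    Finite.of_injective (fun s : PartitionLattice n => fun x y => s x y) fun _ _ h =>
      Setoid.ext fun x y => iff_of_eq (congrFun (congrFun h x) y)
  Fintype.ofFinite _

/-- The number of blocks of a partition. -/
noncomputable def blocks (s : PartitionLattice n) : ℕ := Nat.card (Quotient s)

theorem blocks_strictAnti : StrictAnti (blocks (n := n)) := by
  classical
  intro s t hst
  have : Fintype (Quotient s) := Fintype.ofFinite _
  have : Fintype (Quotient t) := Fintype.ofFinite _
  unfold blocks
  rw [Nat.card_eq_fintype_card, Nat.card_eq_fintype_card]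
  refine Fintype.card_lt_of_surjective_not_injective
    (Quotient.map' (s₁ := s) (s₂ := t) id fun x y h => hst.le h) ?_ fun hinj => ?_
  · rintro ⟨x⟩
    exact ⟨Quotient.mk s x, rfl⟩
  · refine hst.not_ge fun x y h => ?_
    exact Quotient.exact (hinj (a₁ := Quotient.mk s x) (a₂ := Quotient.mk s y) (Quotient.sound h))

theorem blocks_bot : blocks (⊥ : PartitionLattice n) = n := by
  unfold blocks
  have e : Fin n ≃ Quotient (⊥ : Setoid (Fin n)) :=
    Equiv.ofBijective (Quotient.mk _) ⟨fun x y h => Quotient.exact h, Quotient.mk_surjective⟩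
  rw [← Nat.card_congr e, Nat.card_fin]

theorem blocks_pos (hn : 0 < n) (s : PartitionLattice n) : 0 < blocks s :=
  have : Nonempty (Quotient s) := ⟨Quotient.mk _ ⟨0, hn⟩⟩
  Nat.card_pos

/-- A strictly increasing sequence of partitions other than `⊥` and `⊤`. -/
structure IsProperChain {p : ℕ} (w : Fin p → PartitionLattice n) : Prop where
  strictMono : StrictMono w
  ne_bot : ∀ j, w j ≠ ⊥
  ne_top : ∀ j, w j ≠ ⊤

namespace IsProperChain

variable {p : ℕ} {w : Fin p → PartitionLattice n}

theorem blocks_lt (hw : IsProperChain w) (j : Fin p) : blocks (w j) < n :=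
  (blocks_strictAnti (bot_lt_iff_ne_bot.2 (hw.ne_bot j))).trans_eq blocks_bot

theorem one_lt_blocks (hw : IsProperChain w) (j : Fin p) : 1 < blocks (w j) := by
  have hn := (Nat.zero_le _).trans_lt (hw.blocks_lt j)
  exact Nat.lt_of_le_of_lt (blocks_pos hn ⊤)
    (blocks_strictAnti (lt_top_iff_ne_top.2 (hw.ne_top j)))

theorem blocks_add_le (hw : IsProperChain w) {i j : Fin p} (hij : i ≤ j) :
    blocks (w j) + (j - i : ℕ) ≤ blocks (w i) := by
  obtain ⟨j, hj⟩ := j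
  obtain ⟨i, hi⟩ := i
  obtain ⟨d, rfl⟩ : ∃ d, j = i + d := ⟨j - i, (Nat.add_sub_cancel' hij).symm⟩
  induction d with
  | zero => simp
  | succ d ih =>
    have h1 := ih (by omega) (Nat.le_add_right i d)
    have h2 := blocks_strictAnti (hw.strictMono
      (show (⟨i + d, by omega⟩ : Fin p) < ⟨i + (d + 1), hj⟩ from by simp))
    simp only [Nat.add_sub_cancel_left] at h1 ⊢
    omega

/-- Block numbers strictly decrease along the chain and stay between 2 and n - 1. -/
theorem length_le (hw : IsProperChain w) : p ≤ n - 2 := by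
  rcases Nat.eq_zero_or_pos p with rfl | hp
  · exact Nat.zero_le _
  have h1 := hw.blocks_add_le (i := ⟨0, hp⟩) (j := ⟨p - 1, by omega⟩) (Nat.zero_le (p - 1))
  have h2 := hw.blocks_lt ⟨0, hp⟩
  have h3 := hw.one_lt_blocks ⟨p - 1, by omega⟩
  simp only at h1
  omega

/-- At the maximal length there is no slack, so exactly one block is lost at each step. The position
of a partition in the chain is therefore determined by its number of blocks. -/
theorem blocks_eq (hw : IsProperChain w) (hp : p = n - 2) (j : Fin p) :
    blocks (w j) + j + 1 = n := by
  have hj := j.2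
  have h0 := hw.blocks_add_le (i := ⟨0, by omega⟩) (j := j) (Nat.zero_le j.1)
  have h1 := hw.blocks_add_le (i := j) (j := ⟨p - 1, by omega⟩) (Nat.le_sub_one_of_lt j.2)
  have h2 := hw.blocks_lt ⟨0, by omega⟩
  have h3 := hw.one_lt_blocks ⟨p - 1, by omega⟩
  simp only at h0 h1
  omega

end IsProperChain

/-- If `t` has one block less than `s < t`, it is obtained from `s` by merging two blocks. -/
theorem rel_iff_of_blocks_eq {s t : PartitionLattice n} (hst : s ≤ t)
    (hb : blocks t + 1 = blocks s) {x y : Fin n} (ht : t x y) (hs : ¬ s x y) (a b : Fin n) :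
    t a b ↔ s a b ∨ ((s a x ∨ s a y) ∧ (s b x ∨ s b y)) := by
  have hsymm : ∀ {a b}, s a b → s b a := fun h => Setoid.symm' s h
  have htrans : ∀ {a b c}, s a b → s b c → s a c := fun h h' => Setoid.trans' s h h'
  -- `m` merges the blocks of x and y in s. It lies strictly above s and below t, and the block
  -- numbers leave no room between s and t, so m = t.
  let m : PartitionLattice n :=
    { r := fun a b => s a b ∨ ((s a x ∨ s a y) ∧ (s b x ∨ s b y))
      iseqv := by
        refine ⟨fun a => Or.inl (Setoid.refl' s a), fun {a b} h => ?_, fun {a b c} h h' => ?_⟩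
        · exact h.imp hsymm And.symm
        · rcases h with h | ⟨h1, h2⟩
          · rcases h' with h' | ⟨h3, h4⟩
            · exact Or.inl (htrans h h')
            · exact Or.inr ⟨h3.imp (htrans h) (htrans h), h4⟩
          · rcases h' with h' | ⟨h3, h4⟩
            · exact Or.inr ⟨h1, h2.imp (htrans (hsymm h')) (htrans (hsymm h'))⟩
            · exact Or.inr ⟨h1, h4⟩ }
  have hsm : s < m := by
    refine lt_of_le_of_ne (fun a b h => Or.inl h) fun h => hs ?_
    rw [h]
    exact Or.inr ⟨Or.inl (Setoid.refl' s x), Or.inr (Setoid.refl' s y)⟩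
  have hmt : m ≤ t := by
    rintro a b (h | ⟨h1, h2⟩)
    · exact hst h
    · have key : ∀ c, s c x ∨ s c y → t c x := fun c h =>
        h.elim (fun h => hst h) fun h => Setoid.trans' t (hst h) (Setoid.symm' t ht)
      exact Setoid.trans' t (key a h1) (Setoid.symm' t (key b h2))
  have hm : m = t := by
    by_contra hne
    have h1 := blocks_strictAnti (lt_of_le_of_ne hmt hne)
    have h2 := blocks_strictAnti hsm
    omega
  rw [← hm]
  rfl

variable {p : ℕ} {w : Fin p → PartitionLattice n}

/-- Treats the first step like the others, with ⊥ as the predecessor of `w 0`. -/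
theorem IsProperChain.exists_predecessor (hw : IsProperChain w) (hp : p = n - 2) (j : Fin p) :
    ∃ s < w j, blocks (w j) + 1 = blocks s ∧ ∀ a b, s a b ↔ a = b ∨ ∃ i < j, w i a b := by
  have hj := hw.blocks_eq hp j
  obtain ⟨_ | j, hjp⟩ := j
  · refine ⟨⊥, bot_lt_iff_ne_bot.2 (hw.ne_bot _), by rw [blocks_bot]; exact hj, fun a b => ?_⟩
    have : ¬ ∃ i < (⟨0, hjp⟩ : Fin p), w i a b := fun ⟨i, hi, _⟩ => absurd hi (by simp [Fin.lt_def])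
    simp only [this, or_false]
    rfl
  · have hlt : (⟨j, by omega⟩ : Fin p) < ⟨j + 1, hjp⟩ := by simp
    have := hw.blocks_eq hp ⟨j, by omega⟩
    refine ⟨w ⟨j, by omega⟩, hw.strictMono hlt, by simp only at this hj; omega, fun a b =>
      ⟨fun h => Or.inr ⟨_, hlt, h⟩, ?_⟩⟩
    rintro (rfl | ⟨i, hi, h⟩)
    · exact Setoid.refl' _ _
    · exact hw.strictMono.monotone (show i ≤ ⟨j, _⟩ from Nat.le_of_lt_succ hi) h

/-- Every step of a maximal chain of partitions creates one new block. -/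
theorem IsProperChain.exists_cluster (hw : IsProperChain w) (hp : p = n - 2) (j : Fin p) :
    ∃ S : Cluster n, (∀ x ∈ S, ∀ y, w j x y ↔ y ∈ S) ∧
      (∀ a b, w j a b ↔ a = b ∨ (∃ i < j, w i a b) ∨ (a ∈ S ∧ b ∈ S)) ∧
      ∃ x ∈ S, ∃ y ∈ S, x ≠ y ∧ ∀ i < j, ¬ w i x y := by
  obtain ⟨s, hs, hb, hsr⟩ := hw.exists_predecessor hp j
  obtain ⟨x, y, hxy, hxy'⟩ : ∃ x y, w j x y ∧ ¬ s x y := by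
    by_contra! h
    exact hs.not_ge fun a b => h a b
  have key := rel_iff_of_blocks_eq hs.le hb hxy hxy'
  have hne : x ≠ y := fun h => hxy' ((hsr x y).2 (Or.inl h))
  have hcl : ∀ a, w j a x ↔ s a x ∨ s a y := fun a => by
    rw [key]
    have := Setoid.refl' s x
    tauto
  -- The cluster is the block of x in `w j`, which is the union of the blocks of x and y in the
  -- predecessor s.
  refine ⟨⟨{a | w j a x}, ⟨x, Setoid.refl' _ x, y, Setoid.symm' _ hxy, hne⟩, fun h => ?_⟩, ?_, ?_,
    x, Setoid.refl' _ x, y, Setoid.symm' _ hxy, hne, fun i hi h => hxy' ((hsr x y).2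
      (Or.inr ⟨i, hi, h⟩))⟩
  · refine hw.ne_top j (top_le_iff.1 fun a b _ => ?_)
    have h1 : ∀ a, w j a x := fun a => by
      have : a ∈ {a | w j a x} := h ▸ Set.mem_univ a
      exact this
    exact Setoid.trans' _ (h1 a) (Setoid.symm' _ (h1 b))
  · intro a (ha : w j a x) b
    change w j a b ↔ w j b x
    exact ⟨fun h => Setoid.trans' _ (Setoid.symm' _ h) ha,
      fun h => Setoid.trans' _ ha (Setoid.symm' _ h)⟩
  · intro a b
    change _ ↔ _ ∨ _ ∨ (w j a x ∧ w j b x)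
    rw [hcl, hcl, key, hsr, or_assoc]

/-- The list consists of the blocks newly formed at each step. Blocks of an increasing chain are
nested or disjoint. A later cluster is not contained in an earlier one, because it contains a pair
that was not yet related. -/
theorem IsProperChain.exists_merge_eq (hw : IsProperChain w) (hp : p = n - 2) :
    ∃ v : Fin p → Cluster n, Cluster.Sorted v ∧ Cluster.merge v = w := by
  choose v h1 h2 h3 using hw.exists_cluster hp
  have hv : Cluster.Sorted v := by
    intro i j hij
    obtain ⟨x, hx, y, hy, -, hxy⟩ := h3 j
    by_cases hd : Disjoint (v i : Set (Fin n)) (v j)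
    · exact Or.inr hd
    left
    obtain ⟨a, ha, ha'⟩ := Set.not_disjoint_iff.1 hd
    have hsub : (v i : Set (Fin n)) ⊆ v j := fun b hb =>
      (h1 j a ha' b).1 (hw.strictMono.monotone hij.le ((h1 i a ha b).2 hb))
    refine hsub.ssubset_of_not_subset fun h => hxy i hij ((h1 i x (h hx) y).2 (h hy))
  refine ⟨v, hv, ?_⟩
  have key : ∀ m : ℕ, ∀ j : Fin p, j.1 = m → Cluster.merge v j = w j := by
    intro m
    induction m using Nat.strong_induction_on with
    | _ m ih =>
      rintro j rfl
      refine Setoid.ext fun a b => ?_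
      rw [Cluster.merge_iff hv, h2]
      constructor
      · rintro (h | ⟨i, hi, ha, hb⟩)
        · exact Or.inl h
        · rcases hi.eq_or_lt with rfl | hi
          · exact Or.inr (Or.inr ⟨ha, hb⟩)
          · exact Or.inr (Or.inl ⟨i, hi, (h1 i a ha b).2 hb⟩)
      · rintro (h | ⟨i, hi, h⟩ | h)
        · exact Or.inl h
        · rw [← ih i hi i rfl, Cluster.merge_iff hv] at h
          exact h.imp_right fun ⟨k, hk, h⟩ => ⟨k, hk.trans hi.le, h⟩
        · exact Or.inr ⟨j, le_rfl, h⟩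
  exact funext fun j => key j j rfl

end PartitionLattice

/-! ### The complex of compatible families, and sorting its faces -/

namespace Cluster

variable {n p : ℕ} {v : Fin p → Cluster n}

theorem Sorted.isProperChain (hv : Sorted v) : PartitionLattice.IsProperChain (merge v) :=
  ⟨merge_strictMono hv, merge_ne_bot, merge_ne_top hv⟩

/-- The bound on the number of compatible clusters is inherited from chains of partitions. -/
theorem Sorted.length_le (hv : Sorted v) : p ≤ n - 2 := hv.isProperChain.length_le

end Cluster

/-- The complex of compatible families of clusters. -/
def laminarComplex (n : ℕ) : PreAbstractSimplicialComplex (Cluster n) where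
  faces := {s | s.Nonempty ∧ ∀ S ∈ s, ∀ S' ∈ s, S.Compatible S'}
  isRelLowerSet_faces := by
    rintro s ⟨hs, h⟩
    exact ⟨hs, fun t hts ht => ⟨ht, fun S hS S' hS' => h S (hts hS) S' (hts hS')⟩⟩

namespace SimplicialHomology

theorem isFaceTuple_laminarComplex_iff {n p : ℕ} {v : Fin p → Cluster n} :
    IsFaceTuple (laminarComplex n) v ↔
      Function.Injective v ∧ ∀ i j, (v i).Compatible (v j) := by
  classical
  refine and_congr_right fun _ => ⟨?_, fun h => ?_⟩
  · rintro (rfl | ⟨s, hs, hsv⟩) i j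
    · exact i.elim0
    · have hmem : ∀ i, v i ∈ s := fun i => Finset.mem_coe.1 (hsv ▸ ⟨i, rfl⟩)
      exact hs.2 _ (hmem i) _ (hmem j)
  · rcases Nat.eq_zero_or_pos p with hp | hp
    · exact Or.inl hp
    · refine Or.inr ⟨Finset.univ.image v, ⟨⟨v ⟨0, hp⟩, by simp⟩, ?_⟩, by simp⟩
      simpa using h

theorem isFaceTuple_orderComplex_iff {L : Type*} [PartialOrder L] [BoundedOrder L] {p : ℕ}
    {w : Fin p → L} :
    IsFaceTuple (orderComplex L) w ↔
      Function.Injective w ∧ (∀ i j, w i ≤ w j ∨ w j ≤ w i) ∧ ∀ j, w j ≠ ⊥ ∧ w j ≠ ⊤ := by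
  classical
  refine and_congr_right fun hinj => ⟨?_, fun h => ?_⟩
  · rintro (rfl | ⟨s, ⟨-, hs, hb, ht⟩, hsv⟩)
    · exact ⟨fun i => i.elim0, fun i => i.elim0⟩
    · have hmem : ∀ i, w i ∈ s := fun i => Finset.mem_coe.1 (hsv ▸ ⟨i, rfl⟩)
      exact ⟨fun i j => hs.total (hmem i) (hmem j),
        fun j => ⟨fun h => hb (h ▸ hmem j), fun h => ht (h ▸ hmem j)⟩⟩
  · rcases Nat.eq_zero_or_pos p with hp | hp
    · exact Or.inl hp
    · refine Or.inr ⟨Finset.univ.image w, ⟨⟨w ⟨0, hp⟩, by simp⟩, ?_, ?_, ?_⟩, by simp⟩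
      · rw [Finset.coe_image, Finset.coe_univ, Set.image_univ]
        rintro _ ⟨i, rfl⟩ _ ⟨j, rfl⟩ _
        exact h.1 i j
      · simpa using fun j => (h.2 j).1
      · simpa using fun j => (h.2 j).2

end SimplicialHomology

open SimplicialHomology

namespace PartitionLattice

variable {n p : ℕ} {w : Fin p → PartitionLattice n}

theorem IsProperChain.isFaceTuple (hw : IsProperChain w) :
    IsFaceTuple (orderComplex (PartitionLattice n)) w :=
  isFaceTuple_orderComplex_iff.2 ⟨hw.strictMono.injective,
    fun i j => (le_total i j).imp (fun h => hw.strictMono.monotone h)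
      fun h => hw.strictMono.monotone h, fun j => ⟨hw.ne_bot j, hw.ne_top j⟩⟩

theorem exists_isProperChain_comp (hw : IsFaceTuple (orderComplex (PartitionLattice n)) w) :
    ∃ σ : Equiv.Perm (Fin p), IsProperChain (w ∘ σ) := by
  obtain ⟨hinj, hcomp, hne⟩ := isFaceTuple_orderComplex_iff.1 hw
  -- The sign is there because block numbers decrease as partitions grow.
  set κ : Fin p → ℤ := fun j => -(blocks (w j) : ℤ)
  refine ⟨Tuple.sort κ, fun i j hij => ?_, fun j => (hne _).1, fun j => (hne _).2⟩
  have hle := Tuple.monotone_sort κ hij.le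
  have hne' : (w ∘ Tuple.sort κ) i ≠ (w ∘ Tuple.sort κ) j := fun h =>
    hij.ne ((Tuple.sort κ).injective (hinj h))
  rcases hcomp (Tuple.sort κ i) (Tuple.sort κ j) with h | h
  · exact lt_of_le_of_ne h hne'
  · have := blocks_strictAnti (lt_of_le_of_ne h hne'.symm)
    simp only [κ, Function.comp_apply] at hle this
    omega

/-- Replacing an element of a maximal chain of partitions keeps the order. -/
theorem IsProperChain.update (hw : IsProperChain w) (hp : p = n - 2) {k : Fin p}
    {x : PartitionLattice n}
    (hx : IsFaceTuple (orderComplex (PartitionLattice n)) (Function.update w k x)) :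
    IsProperChain (Function.update w k x) := by
  obtain ⟨σ, hσ⟩ := exists_isProperChain_comp hx
  -- The block number fixes the position of every unchanged entry. So the sorting permutation fixes
  -- all indices except possibly one, hence that one too.
  have hfix : ∀ i, σ i ≠ k → σ i = i := fun i hi => by
    have h1 := hσ.blocks_eq hp i
    have h2 := hw.blocks_eq hp (σ i)
    rw [Function.comp_apply, Function.update_of_ne hi] at h1
    exact Fin.ext (by omega)
  have hσ1 : σ = 1 := by
    refine Equiv.ext fun i => ?_
    by_cases hi : σ i = k
    · by_contra hne
      have h1 : σ (σ i) = σ i := hfix (σ i) fun h => hne (σ.injective (h.trans hi.symm))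
      exact hne (σ.injective h1)
    · exact hfix i hi
  rw [hσ1] at hσ
  exact hσ

/-- Such a permutation is an order automorphism of `Fin p`. A chain of partitions, unlike a family
of clusters, has only one admissible order. -/
theorem eq_one_of_isProperChain_comp (hw : IsProperChain w) (σ : Equiv.Perm (Fin p))
    (hσ : IsProperChain (w ∘ σ)) : σ = 1 := by
  have hmono : StrictMono σ := fun i j hij => hw.strictMono.lt_iff_lt.1 (hσ.strictMono hij)
  have : (⟨σ, hmono.le_iff_le⟩ : Fin p ≃o Fin p) = OrderIso.refl _ := Subsingleton.elim _ _
  exact Equiv.ext fun i => DFunLike.congr_fun this i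

end PartitionLattice

/-! ### Exchanging one cluster in a sorted maximal family -/

namespace Cluster

variable {n p : ℕ} {v : Fin p → Cluster n}

theorem Sorted.isFaceTuple (hv : Sorted v) : IsFaceTuple (laminarComplex n) v :=
  isFaceTuple_laminarComplex_iff.2 ⟨hv.injective, hv.compatible⟩

/-- A compatible family can be sorted by any key that is monotone under inclusion. -/
theorem exists_sorted_comp (hv : IsFaceTuple (laminarComplex n) v) (κ : Cluster n → ℕ)
    (hκ : ∀ S S' : Cluster n, (S : Set (Fin n)) ⊂ S' → κ S < κ S') :
    ∃ σ : Equiv.Perm (Fin p), Sorted (v ∘ σ) ∧ Monotone (κ ∘ v ∘ σ) := by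
  obtain ⟨hinj, hcomp⟩ := isFaceTuple_laminarComplex_iff.1 hv
  refine ⟨Tuple.sort (κ ∘ v), fun i j hij => ?_, Tuple.monotone_sort (κ ∘ v)⟩
  have hle := Tuple.monotone_sort (κ ∘ v) hij.le
  set σ := Tuple.sort (κ ∘ v)
  have hne : (v (σ i) : Set (Fin n)) ≠ v (σ j) := fun h =>
    hij.ne (σ.injective (hinj (SetLike.coe_injective h)))
  rcases hcomp (σ i) (σ j) with h | h | h
  · exact Or.inl (h.ssubset_of_ne hne)
  · have := hκ _ _ (h.ssubset_of_ne hne.symm)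
    simp only [Function.comp_apply] at hle
    omega
  · exact Or.inr h

theorem ncard_lt_ncard (S S' : Cluster n) (h : (S : Set (Fin n)) ⊂ S') :
    (S : Set (Fin n)).ncard < (S' : Set (Fin n)).ncard :=
  Set.ncard_lt_ncard h (Set.toFinite _)

theorem exists_sorted (hv : IsFaceTuple (laminarComplex n) v) :
    ∃ σ : Equiv.Perm (Fin p), Sorted (v ∘ σ) :=
  (exists_sorted_comp hv _ ncard_lt_ncard).imp fun _ h => h.1

theorem length_le_of_isFaceTuple (hv : IsFaceTuple (laminarComplex n) v) : p ≤ n - 2 :=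
  (exists_sorted hv).choose_spec.length_le

/-- The cluster in position `k` is last or contained in its successor. -/
def NestedAt (v : Fin p → Cluster n) (k : Fin p) : Prop :=
  ∀ k' : Fin p, k'.1 = k.1 + 1 → (v k : Set (Fin n)) ⊂ v k'

open Classical in
/-- Every marked vertex of a simplex can be made nested by sorting appropriately. -/
theorem exists_sorted_nestedAt (hv : IsFaceTuple (laminarComplex n) v) (k : Fin p) :
    ∃ σ : Equiv.Perm (Fin p), Sorted (v ∘ σ) ∧ NestedAt (v ∘ σ) (σ.symm k) := by
  -- Clusters have at most n elements, so the bonus n + 1 sorts all clusters containing `v k` behind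
  -- all others. Among those containing it, `v k` is the smallest. Hence everything sorted after `v
  -- k` contains it.
  set κ : Cluster n → ℕ := fun S =>
    (if (v k : Set (Fin n)) ⊆ S then n + 1 else 0) + (S : Set (Fin n)).ncard with hκ
  have hn : ∀ S : Cluster n, (S : Set (Fin n)).ncard ≤ n := fun S =>
    (Set.ncard_le_card _).trans_eq (Nat.card_fin n)
  obtain ⟨σ, hσ, hmono⟩ := exists_sorted_comp hv κ fun S S' h => by
    have h1 := ncard_lt_ncard S S' h
    by_cases hS : (v k : Set (Fin n)) ⊆ S
    · simp only [hκ, if_pos hS, if_pos (hS.trans h.subset)]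
      omega
    · simp only [hκ, if_neg hS]
      omega
  refine ⟨σ, hσ, fun k' hk' => ?_⟩
  have hlt : σ.symm k < k' := Fin.lt_def.2 (by omega)
  have h1 := hmono hlt.le
  simp only [hκ, Function.comp_apply, Equiv.apply_symm_apply, subset_rfl, if_true] at h1
  have h2 := hn (v (σ k'))
  by_cases h : (v k : Set (Fin n)) ⊆ v (σ k')
  · obtain ⟨x, hx⟩ := (v k).nonempty
    exact hσ.ssubset_of_mem (x := x) hlt (by simpa using hx) (h hx)
  · rw [if_neg h] at h1
    omega

/-- A new cluster y is incompatible with `v k`, for otherwise there would be n - 1 compatible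
clusters. So y lies in no earlier cluster, since these are contained in or disjoint from `v k`. It
must lie in the next cluster, since every other relation to that larger set would make y compatible
with `v k`. -/
theorem Sorted.update (hv : Sorted v) (hp : p = n - 2) {k : Fin p} (hk : NestedAt v k)
    {y : Cluster n} (hy : IsFaceTuple (laminarComplex n) (Function.update v k y)) :
    Sorted (Function.update v k y) ∧ ∀ k' : Fin p, k'.1 = k.1 + 1 → (y : Set (Fin n)) ⊆ v k' := by
  by_cases hyk : y = v k
  · subst hyk
    rw [Function.update_eq_self]
    exact ⟨hv, fun k' hk' => (hk k' hk').subset⟩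
  obtain ⟨hinj, hcomp⟩ := isFaceTuple_laminarComplex_iff.1 hy
  have hcy : ∀ i, i ≠ k → Compatible y (v i) := fun i hi => by
    simpa [hi] using hcomp k i
  have hne : ∀ i, i ≠ k → (y : Set (Fin n)) ≠ v i := fun i hi h => by
    refine hi (hinj ?_).symm
    simpa [hi] using SetLike.coe_injective h
  have hnc : ¬ Compatible y (v k) := fun hc => by
    have hface : IsFaceTuple (laminarComplex n) (Fin.cons y v : Fin (p + 1) → Cluster n) := by
      have hcy' : ∀ i, Compatible y (v i) := fun i => by
        by_cases hi : i = k
        exacts [hi ▸ hc, hcy i hi]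
      refine isFaceTuple_laminarComplex_iff.2 ⟨Fin.cons_injective_iff.2 ⟨?_, hv.injective⟩, ?_⟩
      · rintro ⟨i, hi⟩
        by_cases h : i = k
        · exact hyk (hi ▸ h ▸ rfl)
        · exact hne i h (by rw [hi])
      · refine Fin.cases (Fin.cases (Or.inl subset_rfl) fun j => ?_)
          fun i => Fin.cases ?_ fun j => ?_
        · simpa using hcy' j
        · simpa using (hcy' i).symm
        · simpa using hv.compatible i j
    have := length_le_of_isFaceTuple hface
    omega
  have h1 : ∀ i < k, ¬ (y : Set (Fin n)) ⊆ v i := fun i hi h => hnc <| by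
    rcases hv i k hi with h' | h'
    · exact Or.inl (h.trans h'.subset)
    · exact Or.inr (Or.inr (h'.mono_left h))
  have h2 : ∀ k' : Fin p, k'.1 = k.1 + 1 → (y : Set (Fin n)) ⊆ v k' := fun k' hk' => by
    by_contra h
    refine hnc ?_
    rcases hcy k' (fun h => by subst h; omega) with h' | h' | h'
    · exact absurd h' h
    · exact Or.inr (Or.inl ((hk k' hk').subset.trans h'))
    · exact Or.inr (Or.inr (h'.mono_right (hk k' hk').subset))
  refine ⟨fun i j hij => ?_, h2⟩
  by_cases hi : i = k
  · subst hi
    rw [Function.update_self, Function.update_of_ne hij.ne']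
    set k' : Fin p := ⟨i.1 + 1, by omega⟩
    have hyk' := h2 k' rfl
    rcases (show k' ≤ j from Nat.succ_le_of_lt hij).eq_or_lt with h | h
    · exact Or.inl (h ▸ hyk'.ssubset_of_ne (hne k' (h ▸ hij.ne')))
    · exact (hv k' j h).imp hyk'.trans_ssubset fun h => h.mono_left hyk'
  · rw [Function.update_of_ne hi]
    by_cases hj : j = k
    · subst hj
      rw [Function.update_self]
      rcases hcy i hi with h | h | h
      · exact absurd h (h1 i hij)
      · exact Or.inl (h.ssubset_of_ne (hne i hi).symm)
      · exact Or.inr h.symm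
    · rw [Function.update_of_ne hj]
      exact hv i j hij

/-- Before step k neither filling is seen, and after it both `v k` and y are absorbed by the cluster
in position k + 1. -/
theorem merge_update (hv : Sorted v) (hp : p = n - 2) {k : Fin p} (hk : NestedAt v k)
    {y : Cluster n} (hy : IsFaceTuple (laminarComplex n) (Function.update v k y)) {j : Fin p}
    (hj : j ≠ k) : merge (Function.update v k y) j = merge v j := by
  obtain ⟨hs, hyk⟩ := hv.update hp hk hy
  refine Setoid.ext fun a b => ?_
  rw [merge_iff hs, merge_iff hv]
  refine or_congr_right ⟨?_, ?_⟩
  · rintro ⟨i, hi, ha, hb⟩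
    by_cases hik : i = k
    · subst hik
      rw [Function.update_self] at ha hb
      have := lt_of_le_of_ne hi hj.symm
      set k' : Fin p := ⟨i.1 + 1, by omega⟩
      exact ⟨k', Nat.succ_le_of_lt this, hyk k' rfl ha, hyk k' rfl hb⟩
    · rw [Function.update_of_ne hik] at ha hb
      exact ⟨i, hi, ha, hb⟩
  · rintro ⟨i, hi, ha, hb⟩
    by_cases hik : i = k
    · subst hik
      have := lt_of_le_of_ne hi hj.symm
      set k' : Fin p := ⟨i.1 + 1, by omega⟩
      have hne : k' ≠ i := fun h => by simpa [k'] using congrArg Fin.val h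
      refine ⟨k', Nat.succ_le_of_lt this, ?_⟩
      rw [Function.update_of_ne hne]
      exact ⟨(hk k' rfl).subset ha, (hk k' rfl).subset hb⟩
    · exact ⟨i, hi, by rwa [Function.update_of_ne hik], by rwa [Function.update_of_ne hik]⟩

/-! ### Lists of clusters whose chains agree off one position -/

variable {v' : Fin p → Cluster n} {k : Fin p}

/-- The cluster at step j is recovered from the partitions up to j. For j > k + 1 the unknown
partition in position k can be ignored, because the one in position k + 1 is coarser and also
precedes j. -/
theorem eq_of_merge_eq_off (hv : Sorted v) (hv' : Sorted v')
    (h : ∀ j, j ≠ k → merge v' j = merge v j) {j : Fin p} (hj : j ≠ k) (hj' : j.1 ≠ k.1 + 1) :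
    v' j = v j := by
  refine SetLike.ext fun x => ?_
  rw [mem_iff_merge hv, mem_iff_merge hv', h j hj]
  refine exists_congr fun y => and_congr_right fun _ => and_congr_right fun _ => ?_
  have key : ∀ u : Fin p → Cluster n, (∀ i < j, ¬ merge u i x y) ↔
      ∀ i < j, i ≠ k → ¬ merge u i x y := fun u => by
    refine ⟨fun h i hi _ => h i hi, fun h i hi hm => ?_⟩
    by_cases hik : i = k
    · subst hik
      have hi' : i.1 < j.1 := hi
      exact h ⟨i.1 + 1, by omega⟩ (Fin.lt_def.2 (by simp only; omega))
        (fun h => by simpa using congrArg Fin.val h)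
        (merge_mono (show i ≤ ⟨i.1 + 1, _⟩ from Nat.le_succ _) hm)
    · exact h i hi hik hm
  rw [key, key]
  refine forall_congr' fun i => forall_congr' fun _ => forall_congr' fun hik => ?_
  rw [h i hik]

/-- Two elements that get related by `v'` at step `k` or `k + 1` lie in one of the clusters
of `v` with these positions. -/
theorem exists_mem_of_merge_eq_off (hv : Sorted v)
    (h : ∀ j, j ≠ k → merge v' j = merge v j) {k' : Fin p} (hk' : k'.1 = k.1 + 1) {x y : Fin n}
    (hxy : x ≠ y) (hm : merge v' k' x y) (hn : ∀ i < k, ¬ merge v' i x y) :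
    (x ∈ v k ∧ y ∈ v k) ∨ (x ∈ v k' ∧ y ∈ v k') := by
  rw [h k' (fun h => by subst h; omega)] at hm
  rcases (merge_iff hv).1 hm with h' | ⟨i, hi, h1, h2⟩
  · exact absurd h' hxy
  rcases hi.eq_or_lt with rfl | hi
  · exact Or.inr ⟨h1, h2⟩
  rcases (show i ≤ k from Fin.le_def.2 (by have := Fin.lt_def.1 hi; omega)).eq_or_lt with rfl | hi
  · exact Or.inl ⟨h1, h2⟩
  · exact absurd (h i hi.ne ▸ merge_of_mem le_rfl h1 h2) (hn i hi)

theorem eq_of_rel_iff {S S' : Cluster n} {s : Setoid (Fin n)} {x : Fin n}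
    (hS : ∀ y, s x y ↔ y ∈ S) (hS' : ∀ y, s x y ↔ y ∈ S') : S = S' :=
  SetLike.ext fun y => (hS y).symm.trans (hS' y)

/-- Besides position k only position k + 1 is in doubt. There both clusters are blocks of the same
partition. They meet because a pair newly joined by v' at step k + 1 lies in one of `v k` and its
successor, and `v k` is contained in its successor. -/
theorem exists_update_eq (hv : Sorted v) (hv' : Sorted v') (hk : NestedAt v k)
    (h : ∀ j, j ≠ k → merge v' j = merge v j) : ∃ y, v' = Function.update v k y := by
  refine ⟨v' k, funext fun j => ?_⟩
  by_cases hj : j = k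
  · subst hj
    rw [Function.update_self]
  rw [Function.update_of_ne hj]
  by_cases hj' : j.1 = k.1 + 1
  · obtain ⟨x, hx, y, hy, hne, hxy⟩ := hv'.exists_split j
    have hkj : k < j := Fin.lt_def.2 (by omega)
    have hmem : x ∈ v j := by
      rcases exists_mem_of_merge_eq_off hv h hj' hne (merge_of_mem le_rfl hx hy)
        (fun i hi => hxy i (hi.trans hkj)) with h' | h'
      exacts [(hk j hj').subset h'.1, h'.1]
    exact eq_of_rel_iff (fun y => merge_iff_of_mem hv' hx)
      (fun y => by rw [h j hj]; exact merge_iff_of_mem hv hmem)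
  · exact eq_of_merge_eq_off hv hv' h hj hj'

theorem merge_iff_of_mem_of_disjoint (hv : Sorted v) {k' : Fin p} (hk' : k'.1 = k.1 + 1)
    (hd : Disjoint (v k : Set (Fin n)) (v k')) {x y : Fin n} (hx : x ∈ v k) :
    merge v k' x y ↔ y ∈ v k := by
  have hlt : k < k' := Fin.lt_def.2 (by omega)
  refine ⟨fun h => ?_, fun hy => merge_of_mem hlt.le hx hy⟩
  rcases (merge_iff hv).1 h with rfl | ⟨i, hi, h1, h2⟩
  · exact hx
  rcases hi.eq_or_lt with rfl | hi
  · exact absurd h1 (Set.disjoint_left.1 hd hx)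
  · exact hv.subset_of_mem (show i ≤ k from Fin.le_def.2 (by have := Fin.lt_def.1 hi; omega)) h1 hx h2

/-- Steps k and k + 1 together form two disjoint blocks, and the only freedom is which comes first.
The work lies in excluding that v' builds one of these blocks in two nested steps. -/
theorem eq_or_eq_swap (hv : Sorted v) (hv' : Sorted v') {k' : Fin p} (hk' : k'.1 = k.1 + 1)
    (hd : Disjoint (v k : Set (Fin n)) (v k')) (h : ∀ j, j ≠ k → merge v' j = merge v j) :
    v' = v ∨ v' = v ∘ Equiv.swap k k' := by
  have hlt : k < k' := Fin.lt_def.2 (by omega)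
  have hcls : ∀ m, m = k ∨ m = k' → ∀ x ∈ v m, ∀ y, merge v' k' x y ↔ y ∈ v m := by
    rintro m hm x hx y
    rw [h k' hlt.ne']
    rcases hm with rfl | rfl
    exacts [merge_iff_of_mem_of_disjoint hv hk' hd hx, merge_iff_of_mem hv hx]
  have hex : ∀ m, m = k ∨ m = k' → ∃ x ∈ v' m, x ∈ v k ∨ x ∈ v k' := fun m hm => by
    have hkm : k ≤ m := by rcases hm with rfl | rfl; exacts [le_rfl, hlt.le]
    have hmk : m ≤ k' := by rcases hm with rfl | rfl; exacts [hlt.le, le_rfl]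
    obtain ⟨x, hx, y, hy, hne, hxy⟩ := hv'.exists_split m
    refine ⟨x, hx, ?_⟩
    exact (exists_mem_of_merge_eq_off hv h hk' hne (merge_of_mem hmk hx hy)
      (fun i hi => hxy i (hi.trans_le hkm))).imp And.left And.left
  have heq : ∀ m, (∀ x ∈ v' m, ∀ y, merge v' k' x y ↔ y ∈ v' m) → (m = k ∨ m = k') →
      v' m = v k ∨ v' m = v k' := fun m hcl hm => by
    obtain ⟨x, hx, hx' | hx'⟩ := hex m hm
    · exact Or.inl (eq_of_rel_iff (hcl x hx) (hcls k (Or.inl rfl) x hx'))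
    · exact Or.inr (eq_of_rel_iff (hcl x hx) (hcls k' (Or.inr rfl) x hx'))
  have hk'eq := heq k' (fun x hx y => merge_iff_of_mem hv' hx) (Or.inr rfl)
  -- If `v' k` were inside `v' k'` = `v m`, every pair newly joined during the two steps would lie
  -- in `v m`. But `v m'` also contains such a pair and is disjoint from `v m`.
  have hdisj : ∀ m m', (m = k ∧ m' = k' ∨ m = k' ∧ m' = k) → v' k' = v m →
      ¬ (v' k : Set (Fin n)) ⊂ v' k' := by
    intro m m' hm hvm hss
    have hd' : Disjoint (v m' : Set (Fin n)) (v m) := by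
      rcases hm with ⟨rfl, rfl⟩ | ⟨rfl, rfl⟩
      exacts [hd.symm, hd]
    have hkm : k ≤ m' := by
      rcases hm with ⟨rfl, rfl⟩ | ⟨rfl, rfl⟩; exacts [hlt.le, le_rfl]
    have hmk : m' ≤ k' := by
      rcases hm with ⟨rfl, rfl⟩ | ⟨rfl, rfl⟩; exacts [le_rfl, hlt.le]
    obtain ⟨x, hx, y, hy, hne, hxy⟩ := hv.exists_split m'
    have hmem := exists_mem_of_merge_eq_off (v := v') (v' := v) hv'
      (fun j hj => (h j hj).symm) hk' hne (merge_of_mem hmk hx hy)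
      (fun i hi => hxy i (hi.trans_le hkm))
    have : x ∈ v' k' := hmem.elim (fun h => hss.subset h.1) And.left
    rw [hvm] at this
    exact Set.disjoint_left.1 hd' hx this
  have hd' : Disjoint (v' k : Set (Fin n)) (v' k') := by
    refine (hv' k k' hlt).resolve_left ?_
    rcases hk'eq with h' | h'
    exacts [hdisj k k' (Or.inl ⟨rfl, rfl⟩) h', hdisj k' k (Or.inr ⟨rfl, rfl⟩) h']
  have hkeq := heq k (fun x hx y => merge_iff_of_mem_of_disjoint hv' hk' hd' hx) (Or.inl rfl)
  have hne : v' k ≠ v' k' := fun h => hlt.ne (hv'.injective h)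
  have hoff : ∀ j, j ≠ k → j ≠ k' → v' j = v j := fun j h1 h2 =>
    eq_of_merge_eq_off hv hv' h h1 fun h3 => h2 (Fin.ext (by omega))
  rcases hkeq with h1 | h1 <;> rcases hk'eq with h2 | h2
  · exact absurd (h1.trans h2.symm) hne
  · left
    funext j
    by_cases hj : j = k
    · rw [hj, h1]
    by_cases hj' : j = k'
    · rw [hj', h2]
    exact hoff j hj hj'
  · right
    funext j
    by_cases hj : j = k
    · rw [hj, h1, Function.comp_apply, Equiv.swap_apply_left]
    by_cases hj' : j = k'
    · rw [hj', h2, Function.comp_apply, Equiv.swap_apply_right]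
    rw [Function.comp_apply, Equiv.swap_apply_of_ne_of_ne hj hj']
    exact hoff j hj hj'
  · exact absurd (h1.trans h2.symm) hne

theorem Sorted.swap (hv : Sorted v) {k' : Fin p} (hk' : k'.1 = k.1 + 1)
    (hd : Disjoint (v k : Set (Fin n)) (v k')) : Sorted (v ∘ Equiv.swap k k') := by
  have hlt : k < k' := Fin.lt_def.2 (by omega)
  intro i j hij
  simp only [Function.comp_apply]
  by_cases h : i = k ∧ j = k'
  · obtain ⟨rfl, rfl⟩ := h
    rw [Equiv.swap_apply_left, Equiv.swap_apply_right]
    exact Or.inr hd.symm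
  · refine hv _ _ ?_
    simp only [Equiv.swap_apply_def, Fin.lt_def, Fin.ext_iff] at *
    split_ifs <;> omega

theorem merge_swap (hv : Sorted v) {k' : Fin p} (hk' : k'.1 = k.1 + 1)
    (hd : Disjoint (v k : Set (Fin n)) (v k')) {j : Fin p} (hj : j ≠ k) :
    merge (v ∘ Equiv.swap k k') j = merge v j := by
  refine Setoid.ext fun a b => ?_
  rw [merge_iff (hv.swap hk' hd), merge_iff hv]
  -- For j ≠ k the indices up to j contain both or neither of k and k + 1, so the swap preserves
  -- them.
  have hle : ∀ i ≤ j, Equiv.swap k k' i ≤ j := fun i hi => by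
    simp only [Equiv.swap_apply_def, Fin.le_def, Fin.ext_iff, ne_eq] at *
    split_ifs <;> omega
  refine or_congr_right ⟨?_, ?_⟩
  · rintro ⟨i, hi, h⟩
    exact ⟨_, hle i hi, h⟩
  · rintro ⟨i, hi, h⟩
    exact ⟨_, hle i hi, by simpa using h⟩

end Cluster

/-! ### Equivariance of merging, and reordering by adjacent swaps -/

namespace Cluster

variable {n : ℕ}

/-- The symmetric group acts on clusters. -/
instance : MulAction (Equiv.Perm (Fin n)) (Cluster n) where
  smul g S := ⟨g.symm ⁻¹' S, S.nontrivial.preimage g.symm.surjective, fun h =>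
    S.ne_univ (by rw [← g.symm.surjective.image_preimage S, h, Set.image_univ,
      g.symm.surjective.range_eq])⟩
  one_smul _ := rfl
  mul_smul _ _ _ := rfl

theorem mem_smul {g : Equiv.Perm (Fin n)} {S : Cluster n} {x : Fin n} :
    x ∈ g • S ↔ g.symm x ∈ S := Iff.rfl

theorem Compatible.smul {S S' : Cluster n} (h : S.Compatible S') (g : Equiv.Perm (Fin n)) :
    (g • S).Compatible (g • S') := by
  rcases h with h | h | h
  exacts [Or.inl (Set.preimage_mono (f := g.symm) h),
    Or.inr (Or.inl (Set.preimage_mono (f := g.symm) h)), Or.inr (Or.inr (h.preimage g.symm))]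

variable {p : ℕ} {v : Fin p → Cluster n}

theorem Sorted.smul (hv : Sorted v) (g : Equiv.Perm (Fin n)) : Sorted (g • v) := by
  intro i j hij
  rcases hv i j hij with h | h
  · exact Or.inl ⟨Set.preimage_mono (f := g.symm) h.1, fun h' =>
      h.2 (g.symm.surjective.preimage_subset_preimage_iff.1 h')⟩
  · exact Or.inr (h.preimage g.symm)

theorem merge_smul (hv : Sorted v) (g : Equiv.Perm (Fin n)) : merge (g • v) = g • merge v := by
  funext j
  refine Setoid.ext fun x y => ?_
  change _ ↔ merge v j (g.symm x) (g.symm y)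
  rw [merge_iff (hv.smul g), merge_iff hv, g.symm.injective.eq_iff]
  rfl

/-- Two orders of a compatible family that extend inclusion differ by a sequence of transpositions
of adjacent disjoint clusters. -/
theorem apply_merge_comp_perm {q : ℕ} {R : Type*} [Ring R]
    (d : (Fin (q + 1) → PartitionLattice n) → R)
    (hd : ∀ (v : Fin (q + 1) → Cluster n) (k k' : Fin (q + 1)), Sorted v → k'.1 = k.1 + 1 →
      Disjoint (v k : Set (Fin n)) (v k') → d (merge (v ∘ Equiv.swap k k')) = - d (merge v))
    {v : Fin (q + 1) → Cluster n} (hv : Sorted v) (σ : Equiv.Perm (Fin (q + 1)))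
    (hσ : Sorted (v ∘ σ)) :
    d (merge (v ∘ σ)) = ((Equiv.Perm.sign σ : ℤˣ) : ℤ) • d (merge v) := by
  -- Exchanging an adjacent descent of σ raises this sum by the size of the descent. The sum is
  -- bounded, so the induction runs on its distance from the bound.
  let m : Equiv.Perm (Fin (q + 1)) → ℕ := fun σ => ∑ i, i.1 * (σ i).1
  have hm : ∀ σ, m σ ≤ (q + 1) * ((q + 1) * (q + 1)) := fun σ => by
    refine (Finset.sum_le_card_nsmul Finset.univ _ ((q + 1) * (q + 1)) fun i _ => ?_).trans ?_
    · exact Nat.mul_le_mul i.2.le (σ i).2.le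
    · simp
  induction hN : (q + 1) * ((q + 1) * (q + 1)) - m σ using Nat.strong_induction_on
    generalizing σ with
  | _ N ih =>
    subst hN
    by_cases hmono : StrictMono σ
    · have : (⟨σ, hmono.le_iff_le⟩ : Fin (q + 1) ≃o Fin (q + 1)) = OrderIso.refl _ :=
        Subsingleton.elim _ _
      have : σ = 1 := Equiv.ext fun i => DFunLike.congr_fun this i
      subst this
      simp
    · rw [Fin.strictMono_iff_lt_succ] at hmono
      push Not at hmono
      obtain ⟨i, hi⟩ := hmono
      set k := i.castSucc
      set k' := i.succ
      have hk' : k'.1 = k.1 + 1 := by simp [k, k']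
      have hne : k ≠ k' := fun h => by rw [h] at hk'; omega
      have hlt : σ k' < σ k := lt_of_le_of_ne hi fun h => hne (σ.injective h).symm
      -- The two clusters occur in opposite orders in the sorted lists v and v ∘ σ, which is
      -- impossible for strictly nested sets.
      have hdis : Disjoint ((v ∘ σ) k : Set (Fin n)) ((v ∘ σ) k') := by
        rcases hσ k k' (Fin.lt_def.2 (by omega)) with h | h
        · exact (hv _ _ hlt).elim (fun h' => absurd h'.subset h.2) fun h' => h'.symm
        · exact h
      have hcomp : (v ∘ σ) ∘ Equiv.swap k k' = v ∘ (σ * Equiv.swap k k' : Equiv.Perm _) := rfl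
      have hs := hσ.swap hk' hdis
      have hlt' : m σ < m (σ * Equiv.swap k k') := by
        have h1 : (∑ i, ((i.1 : ℤ) * ((σ * Equiv.swap k k') i).1 - i.1 * (σ i).1)) =
            (k.1 * ((σ k').1 : ℤ) - k.1 * (σ k).1) + (k'.1 * ((σ k).1 : ℤ) - k'.1 * (σ k').1) := by
          rw [Fintype.sum_eq_add k k' hne]
          · simp
          · rintro x ⟨h1, h2⟩
            simp [Equiv.swap_apply_of_ne_of_ne h1 h2]
        rw [Finset.sum_sub_distrib] at h1
        have h2 : ((σ k').1 : ℤ) < (σ k).1 := by exact_mod_cast hlt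
        have h3 : (k'.1 : ℤ) = k.1 + 1 := by exact_mod_cast hk'
        rw [h3] at h1
        have h4 : (m σ : ℤ) < m (σ * Equiv.swap k k') := by
          simp only [m, Nat.cast_sum, Nat.cast_mul]
          linarith
        exact_mod_cast h4
      have h1 := ih _ (by have := hm (σ * Equiv.swap k k'); omega) (σ * Equiv.swap k k') hs rfl
      have h2 := hd (v ∘ σ) k k' hσ hk' hdis
      rw [hcomp, h1, Equiv.Perm.sign_mul, Equiv.Perm.sign_swap hne] at h2
      simpa using h2.symm

/-! ### The boundary condition at nested and at disjoint positions -/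

section Boundary

variable {R : Type*} [CommRing R] {c : (Fin p → Cluster n) →₀ R}
  {d : (Fin p → PartitionLattice n) →₀ R}

/-- In a nested position, fillings by clusters correspond to fillings by partitions. -/
theorem sum_update_of_nestedAt (hp : p = n - 2) (hc : c ∈ chains R (laminarComplex n) p)
    (hd : d ∈ chains R (orderComplex (PartitionLattice n)) p)
    (hcd : ∀ v, Sorted v → c v = d (merge v)) (hv : Sorted v) {k : Fin p} (hk : NestedAt v k) :
    ∑ y, c (Function.update v k y) = ∑ x, d (Function.update (merge v) k x) := by
  have hface : ∀ {y}, c (Function.update v k y) ≠ 0 →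
      IsFaceTuple (laminarComplex n) (Function.update v k y) := fun h => hc.1 _ h
  have hmerge : ∀ {y}, c (Function.update v k y) ≠ 0 → merge (Function.update v k y) =
      Function.update (merge v) k (merge (Function.update v k y) k) := fun {y} h => by
    funext j
    by_cases hj : j = k
    · subst hj
      rw [Function.update_self]
    · rw [Function.update_of_ne hj, merge_update hv hp hk (hface h) hj]
  -- Only nonzero terms are matched, since these are the ones known to be faces. Injectivity is
  -- `merge_injective`; surjectivity combines `exists_merge_eq` with `exists_update_eq`.
  refine Finset.sum_bij_ne_zero (fun y _ _ => merge (Function.update v k y) k)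
    (fun _ _ _ => Finset.mem_univ _) ?_ ?_ ?_
  · intro y _ hy y' _ hy' h
    have h1 : merge (Function.update v k y) = merge (Function.update v k y') := by
      rw [hmerge hy, hmerge hy', h]
    have := congrFun (merge_injective (hv.update hp hk (hface hy)).1
      (hv.update hp hk (hface hy')).1 h1) k
    simpa using this
  · intro x _ hx
    obtain ⟨v', hv', hvx⟩ := (hv.isProperChain.update hp (hd.1 _ hx)).exists_merge_eq hp
    obtain ⟨y, rfl⟩ := exists_update_eq hv hv' hk fun j hj => by
      rw [hvx, Function.update_of_ne hj]
    refine ⟨y, Finset.mem_univ _, ?_, ?_⟩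
    · rwa [hcd _ hv', hvx]
    · rw [hvx, Function.update_self]
  · intro y _ hy
    rw [← hmerge hy, hcd _ (hv.update hp hk (hface hy)).1]

/-- In a position where two disjoint clusters follow each other, there are two fillings by
partitions. -/
theorem sum_update_of_disjoint (hp : p = n - 2)
    (hd : d ∈ chains R (orderComplex (PartitionLattice n)) p) (hv : Sorted v) {k k' : Fin p}
    (hk' : k'.1 = k.1 + 1) (hdis : Disjoint (v k : Set (Fin n)) (v k')) :
    ∑ x, d (Function.update (merge v) k x) =
      d (merge v) + d (merge (v ∘ Equiv.swap k k')) := by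
  have hs := hv.swap hk' hdis
  have hswap : merge (v ∘ Equiv.swap k k') =
      Function.update (merge v) k (merge (v ∘ Equiv.swap k k') k) := by
    funext j
    by_cases hj : j = k
    · subst hj
      rw [Function.update_self]
    · rw [Function.update_of_ne hj, merge_swap hv hk' hdis hj]
  have hne : k ≠ k' := fun h => by subst h; omega
  rw [Fintype.sum_eq_add (merge v k) (merge (v ∘ Equiv.swap k k') k), Function.update_eq_self,
    ← hswap]
  · intro h
    rw [← h, Function.update_eq_self] at hswap
    have := congrFun (merge_injective hs hv hswap) k
    rw [Function.comp_apply, Equiv.swap_apply_left] at this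
    exact hne (hv.injective this).symm
  · rintro x ⟨h1, h2⟩
    by_contra hx
    -- Any nonzero term is a maximal chain, hence merged from a sorted list that must be v or its
    -- swap.
    obtain ⟨v', hv', hvx⟩ := (hv.isProperChain.update hp (hd.1 _ hx)).exists_merge_eq hp
    have hxk : merge v' k = x := by rw [hvx, Function.update_self]
    rcases eq_or_eq_swap hv hv' hk' hdis fun j hj => by rw [hvx, Function.update_of_ne hj]
      with rfl | rfl
    exacts [h1 hxk.symm, h2 hxk.symm]

end Boundary

/-! ### Matching the cycles of the two complexes -/

section Equivalence

variable {R : Type*} [CommRing R] {q : ℕ} {c : (Fin (q + 1) → Cluster n) →₀ R}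
  {d : (Fin (q + 1) → PartitionLattice n) →₀ R}

theorem boundary_laminar_eq_zero_iff (hc : c ∈ chains R (laminarComplex n) (q + 1)) :
    boundary R _ q c = 0 ↔ ∀ v k, Sorted v ∧ NestedAt v k →
      ∑ y, c (Function.update v k y) = 0 :=
  boundary_eq_zero_iff hc _ fun _ hv => exists_sorted_nestedAt hv 0

theorem boundary_order_eq_zero_iff (hq : q + 1 = n - 2)
    (hd : d ∈ chains R (orderComplex (PartitionLattice n)) (q + 1)) :
    boundary R _ q d = 0 ↔ ∀ (v : Fin (q + 1) → Cluster n) k, Sorted v →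
      ∑ x, d (Function.update (merge v) k x) = 0 := by
  rw [boundary_eq_zero_iff hd (fun w _ => PartitionLattice.IsProperChain w)
    fun w hw => PartitionLattice.exists_isProperChain_comp hw]
  constructor
  · exact fun h v k hv => h _ k hv.isProperChain
  · intro h w k hw
    obtain ⟨v, hv, rfl⟩ := hw.exists_merge_eq hq
    exact h v k hv

/-- The boundary condition at a disjoint position has just two terms, so they cancel. -/
theorem apply_merge_swap (hq : q + 1 = n - 2)
    (hd : d ∈ cycles R (orderComplex (PartitionLattice n)) q) {v : Fin (q + 1) → Cluster n}
    {k k' : Fin (q + 1)} (hv : Sorted v) (hk' : k'.1 = k.1 + 1)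
    (hdis : Disjoint (v k : Set (Fin n)) (v k')) :
    d (merge (v ∘ Equiv.swap k k')) = - d (merge v) := by
  have h := (boundary_order_eq_zero_iff hq hd.1).1 hd.2 v k hv
  rw [sum_update_of_disjoint hq hd.1 hv hk' hdis] at h
  exact (neg_eq_of_add_eq_zero_right h).symm

/-- At nested positions the two sums are equal. At disjoint positions the condition on d holds
automatically because c is alternating, and c needs no test there. -/
theorem boundary_eq_zero_iff_of_matching (hq : q + 1 = n - 2)
    (hc : c ∈ chains R (laminarComplex n) (q + 1))
    (hd : d ∈ chains R (orderComplex (PartitionLattice n)) (q + 1))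
    (hcd : ∀ v, Sorted v → c v = d (merge v)) :
    boundary R _ q c = 0 ↔ boundary R _ q d = 0 := by
  rw [boundary_laminar_eq_zero_iff hc, boundary_order_eq_zero_iff hq hd]
  constructor
  · intro h v k hv
    by_cases hk : NestedAt v k
    · rw [← sum_update_of_nestedAt hq hc hd hcd hv hk, h v k ⟨hv, hk⟩]
    · unfold NestedAt at hk
      push Not at hk
      obtain ⟨k', hk', hn⟩ := hk
      have hdis := (hv k k' (Fin.lt_def.2 (by omega))).resolve_left hn
      rw [sum_update_of_disjoint hq hd hv hk' hdis, ← hcd v hv, ← hcd _ (hv.swap hk' hdis),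
        chains_apply_comp hc, Equiv.Perm.sign_swap fun h => by subst h; omega]
      simp
  · rintro h v k ⟨hv, hk⟩
    rw [sum_update_of_nestedAt hq hc hd hcd hv hk, h v k hv]

theorem exists_order_cycle (hq : q + 1 = n - 2) (hc : c ∈ cycles R (laminarComplex n) q) :
    ∃ d ∈ cycles R (orderComplex (PartitionLattice n)) q, ∀ v, Sorted v → c v = d (merge v) := by
  classical
  obtain ⟨d, hd, hdf⟩ := exists_chain_of_sorted (R := R)
    (K := orderComplex (PartitionLattice n)) PartitionLattice.IsProperChain
    (fun w hw => PartitionLattice.exists_isProperChain_comp hw) (fun w hw => hw.isFaceTuple)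
    (fun w : Fin (q + 1) → PartitionLattice n =>
      if h : ∃ v : Fin (q + 1) → Cluster n, Sorted v ∧ merge v = w then c h.choose else 0)
    -- A maximal chain is sorted by the identity only, so the sign condition is vacuous in this
    -- direction.
    fun w σ hw hσ => by
      rw [PartitionLattice.eq_one_of_isProperChain_comp hw σ hσ]
      simp
  have hcd : ∀ v, Sorted v → c v = d (merge v) := fun v hv => by
    have hex : ∃ v' : Fin (q + 1) → Cluster n, Sorted v' ∧ merge v' = merge v := ⟨v, hv, rfl⟩
    rw [hdf _ hv.isProperChain, dif_pos hex,
      merge_injective hex.choose_spec.1 hv hex.choose_spec.2]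
  exact ⟨d, ⟨hd, (boundary_eq_zero_iff_of_matching hq hc.1 hd hcd).1 hc.2⟩, hcd⟩

/-- Here the sign condition has content: a mere chain d need not be alternating in the order of the
clusters, but a cycle is. -/
theorem exists_laminar_cycle (hq : q + 1 = n - 2)
    (hd : d ∈ cycles R (orderComplex (PartitionLattice n)) q) :
    ∃ c ∈ cycles R (laminarComplex n) q, ∀ v, Sorted v → c v = d (merge v) := by
  obtain ⟨c, hc, hcd⟩ := exists_chain_of_sorted (R := R) (K := laminarComplex n)
    Sorted (fun v hv => exists_sorted hv) (fun v hv => hv.isFaceTuple)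
    (fun v : Fin (q + 1) → Cluster n => d (merge v))
    fun v σ hv hσ => apply_merge_comp_perm d
      (fun v k k' hv hk' hdis => apply_merge_swap hq hd hv hk' hdis) hv σ hσ
  exact ⟨c, ⟨hc, (boundary_eq_zero_iff_of_matching hq hc hd.1 hcd).2 hd.2⟩, hcd⟩

theorem laminarComplex_isInvariant (n : ℕ) :
    IsInvariant (Equiv.Perm (Fin n)) (laminarComplex n) := by
  rintro g s ⟨hs, h⟩
  refine ⟨hs.map, fun S hS S' hS' => ?_⟩
  obtain ⟨T, hT, rfl⟩ := Finset.mem_map.1 hS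
  obtain ⟨T', hT', rfl⟩ := Finset.mem_map.1 hS'
  exact (h T hT T' hT').smul g

end Equivalence

end Cluster

theorem SimplicialHomology.boundaries_eq_bot {ι R : Type*} [CommRing R]
    {K : PreAbstractSimplicialComplex ι} {p : ℕ}
    (h : ∀ v : Fin (p + 2) → ι, ¬ IsFaceTuple K v) : boundaries R K p = ⊥ := by
  rw [eq_bot_iff]
  rintro _ ⟨c, hc, rfl⟩
  have : c = 0 := by
    ext v
    by_contra hv
    exact h v (hc.1 v hv)
  rw [this, map_zero]
  exact zero_mem _

open Cluster in
/-- The top homology of the complex of compatible families of clusters is that of the partition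
lattice. -/
theorem laminarComplex_homologyRep_equiv (R : Type*) [CommRing R] {n q : ℕ} (hq : q + 1 = n - 2) :
    Nonempty ((homologyRep R (laminarComplex_isInvariant n) q).Equiv
      (homologyRep R (orderComplex_partitionLattice_isInvariant n) q)) := by
  let L := {v : Fin (q + 1) → Cluster n // Sorted v}
  let resL : cycles R (laminarComplex n) q →ₗ[R] (L → R) :=
    { toFun := fun c v => c.1 v.1
      map_add' := fun _ _ => rfl
      map_smul' := fun _ _ => rfl }
  let resP : cycles R (orderComplex (PartitionLattice n)) q →ₗ[R] (L → R) :=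
    { toFun := fun d v => d.1 (merge v.1)
      map_add' := fun _ _ => rfl
      map_smul' := fun _ _ => rfl }
  have hL : Function.Injective resL := fun c c' h => Subtype.ext <|
    chains_eq_of_sorted c.2.1 c'.2.1 Sorted (fun v hv => exists_sorted hv)
      fun v hv => congrFun h ⟨v, hv⟩
  have hP : Function.Injective resP := fun d d' h => Subtype.ext <|
    chains_eq_of_sorted d.2.1 d'.2.1 PartitionLattice.IsProperChain
      (fun w hw => PartitionLattice.exists_isProperChain_comp hw) fun w hw => by
        obtain ⟨v, hv, rfl⟩ := hw.exists_merge_eq hq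
        exact congrFun h ⟨v, hv⟩
  -- Both modules of cycles embed in the functions on sorted lists of clusters. Once the images
  -- agree, the isomorphism needs no explicit formula and is characterised by `he`.
  have hrange : LinearMap.range resL = LinearMap.range resP := by
    ext f
    constructor
    · rintro ⟨c, rfl⟩
      obtain ⟨d, hd, h⟩ := exists_order_cycle hq c.2
      exact ⟨⟨d, hd⟩, funext fun v => (h v.1 v.2).symm⟩
    · rintro ⟨d, rfl⟩
      obtain ⟨c, hc, h⟩ := exists_laminar_cycle hq d.2
      exact ⟨⟨c, hc⟩, funext fun v => h v.1 v.2⟩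
  let e := (LinearEquiv.ofInjective resL hL).trans ((LinearEquiv.ofEq _ _ hrange).trans
    (LinearEquiv.ofInjective resP hP).symm)
  have he : ∀ c, resP (e c) = resL c := fun c => by
    have := (LinearEquiv.ofInjective resP hP).apply_symm_apply
      (LinearEquiv.ofEq _ _ hrange (LinearEquiv.ofInjective resL hL c))
    exact congrArg Subtype.val this
  refine subquotientRep_equiv _ _ _ _ e (fun c => ?_) fun g c => ?_
  -- A boundary would need faces with q + 2 = n - 1 vertices, of which there are none in either
  -- complex.
  · rw [boundaries_eq_bot fun v hv => ?_, boundaries_eq_bot fun w hw => ?_]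
    · simp
    · have := (PartitionLattice.exists_isProperChain_comp hw).choose_spec.length_le
      omega
    · have := length_le_of_isFaceTuple hv
      omega
  · have hmem := cycles_le_comap R (orderComplex_partitionLattice_isInvariant n) q g (e c).2
    -- Equivariance can be tested after the injective restriction `resP`, where it reduces to
    -- `merge_smul`.
    refine congrArg Subtype.val (a₂ := (⟨_, hmem⟩ : cycles R _ q)) (hP ?_)
    rw [he]
    funext v
    change tupleRep R _ _ (q + 1) g c.1 v.1 = tupleRep R _ _ (q + 1) g (e c).1 (merge v.1)
    rw [tupleRep_apply, tupleRep_apply, ← merge_smul v.2]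
    exact (congrFun (he c) ⟨_, v.2.smul g⁻¹⟩).symm

/-! ### Rooted trees given by parent functions -/

/-- The graph `G` is the tree with root `r` in which `par x` is the parent of `x`; the height `μ`
decreases from a vertex to its parent. -/
structure SimpleGraph.IsRootedBy {V : Type*} (G : SimpleGraph V) (r : V) (par : V → V)
    (μ : V → ℕ) : Prop where
  par_root : par r = r
  lt : ∀ x, x ≠ r → μ (par x) < μ x
  adj : ∀ x y, G.Adj x y ↔ (x ≠ r ∧ par x = y) ∨ (y ≠ r ∧ par y = x)

namespace SimpleGraph.IsRootedBy

variable {V : Type*} {G : SimpleGraph V} {r : V} {par : V → V} {μ : V → ℕ}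

/-- The graph defined by a parent function. -/
def ofParent (r : V) (par : V → V) (μ : V → ℕ) (h : ∀ x, x ≠ r → μ (par x) < μ x) :
    SimpleGraph V where
  Adj x y := (x ≠ r ∧ par x = y) ∨ (y ≠ r ∧ par y = x)
  symm := ⟨fun _ _ h => h.symm⟩
  loopless := ⟨fun x hx => by
    have : x ≠ r ∧ par x = x := hx.elim id id
    exact (h x this.1).ne (by rw [this.2])⟩

theorem ofParent_isRootedBy (hr : par r = r) (h : ∀ x, x ≠ r → μ (par x) < μ x) :
    (ofParent r par μ h).IsRootedBy r par μ :=
  ⟨hr, h, fun _ _ => Iff.rfl⟩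

/-- The height is the distance from the root and the parent is the neighbour closer to the root. A
step to such a neighbour followed by a geodesic is a path, so uniqueness of paths leaves only one
choice. -/
theorem exists_of_isTree (hG : G.IsTree) (r : V) : ∃ par μ, G.IsRootedBy r par μ := by
  classical
  have hpar : ∀ x, ∃ y, (x = r → y = r) ∧ (x ≠ r → G.Adj x y ∧ G.dist r y < G.dist r x) := by
    intro x
    by_cases hx : x = r
    · exact ⟨r, fun _ => rfl, fun h => absurd hx h⟩
    obtain ⟨p, hp⟩ := hG.connected.exists_walk_length_eq_dist x r
    cases p with
    | nil => exact absurd rfl hx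
    | @cons _ y _ hxy p =>
      refine ⟨y, fun h => absurd h hx, fun _ => ⟨hxy, ?_⟩⟩
      have := dist_le p
      rw [SimpleGraph.dist_comm, SimpleGraph.dist_comm (v := x), ← hp, Walk.length_cons]
      omega
  choose par h1 h2 using hpar
  have huniq : ∀ x y z, G.Adj x y → G.Adj x z → G.dist r y < G.dist r x →
      G.dist r z < G.dist r x → y = z := by
    intro x y z hy hz hy' hz'
    have key : ∀ y, G.Adj x y → G.dist r y < G.dist r x → ∃ p : G.Walk x r, p.IsPath ∧
        p.snd = y := by
      intro y hy hy'
      obtain ⟨p, hp, hpl⟩ := hG.connected.exists_path_of_dist y r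
      refine ⟨Walk.cons hy p, (Walk.cons_isPath_iff _ _).2 ⟨hp, fun hx => ?_⟩, by simp⟩
      have h3 := dist_le (p.dropUntil x hx)
      have h4 := p.length_dropUntil_le_length hx
      rw [SimpleGraph.dist_comm] at h3 hpl
      omega
    obtain ⟨p, hp, rfl⟩ := key y hy hy'
    obtain ⟨p', hp', rfl⟩ := key z hz hz'
    rw [(hG.existsUnique_path x r).unique hp hp']
  refine ⟨par, fun x => G.dist r x, h1 r rfl, fun x hx => (h2 x hx).2, fun x y => ⟨fun h => ?_, ?_⟩⟩
  · have hroot : ∀ {x y}, G.dist r y < G.dist r x → x ≠ r := by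
      rintro x y h rfl
      simp at h
    rcases lt_or_gt_of_ne (hG.dist_ne_of_adj r h) with h' | h'
    · have hy := hroot h'
      exact Or.inr ⟨hy, huniq y _ x (h2 y hy).1 h.symm (h2 y hy).2 h'⟩
    · have hx := hroot h'
      exact Or.inl ⟨hx, huniq x _ y (h2 x hx).1 h (h2 x hx).2 h'⟩
  · rintro (⟨hx, rfl⟩ | ⟨hy, rfl⟩)
    exacts [(h2 x hx).1, (h2 y hy).1.symm]

variable (h : G.IsRootedBy r par μ)
include h

theorem adj_par {x : V} (hx : x ≠ r) : G.Adj x (par x) := (h.adj _ _).2 (Or.inl ⟨hx, rfl⟩)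

theorem par_ne {x : V} (hx : x ≠ r) : par x ≠ x := fun h' => (h.lt x hx).ne (by rw [h'])

/-- Induction from the root. -/
theorem induction {P : V → Prop} (root : P r) (step : ∀ x, x ≠ r → P (par x) → P x) (x : V) :
    P x := by
  induction hm : μ x using Nat.strong_induction_on generalizing x with
  | _ m ih =>
    by_cases hx : x = r
    · exact hx ▸ root
    · exact step x hx (ih _ (hm ▸ h.lt x hx) _ rfl)

/-- Every vertex climbs to the root, and sending a non-root vertex to the edge above it counts the
edges as one fewer than the vertices. -/
theorem isTree [Finite V] : G.IsTree := by
  rw [isTree_iff_connected_and_card]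
  constructor
  · have : Nonempty V := ⟨r⟩
    have key : ∀ x, G.Reachable x r :=
      h.induction (Reachable.refl r) fun x hx ih => (h.adj_par hx).reachable.trans ih
    exact ⟨fun x y => (key x).trans (key y).symm⟩
  · have e : {x : V // x ≠ r} ≃ G.edgeSet := by
      refine Equiv.ofBijective (fun x => ⟨s(x.1, par x.1), h.adj_par x.2⟩) ⟨?_, ?_⟩
      · rintro ⟨x, hx⟩ ⟨y, hy⟩ hxy
        have h1 := congrArg Subtype.val hxy
        simp only [Sym2.eq_iff] at h1
        rcases h1 with ⟨h1, -⟩ | ⟨h1, h2⟩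
        · exact Subtype.ext h1
        · have h3 := h.lt x hx
          have h4 := h.lt y hy
          rw [h2] at h3
          rw [← h1] at h4
          omega
      · rintro ⟨e, he⟩
        induction e using Sym2.ind with
        | _ x y =>
          rcases (h.adj x y).1 he with ⟨hx, rfl⟩ | ⟨hy, rfl⟩
          · exact ⟨⟨x, hx⟩, rfl⟩
          · exact ⟨⟨y, hy⟩, Subtype.ext Sym2.eq_swap⟩
    classical
    have := Fintype.ofFinite V
    rw [← Nat.card_congr e, Nat.card_eq_fintype_card, Nat.card_eq_fintype_card,
      Fintype.card_subtype_compl, Fintype.card_subtype_eq]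
    have : 0 < Fintype.card V := Fintype.card_pos_iff.2 ⟨r⟩
    omega

/-- The neighbours of a vertex are its children and its parent. -/
theorem ncard_neighborSet [Finite V] (x : V) [Decidable (x = r)] :
    (G.neighborSet x).ncard = {y | y ≠ r ∧ par y = x}.ncard + if x = r then 0 else 1 := by
  by_cases hx : x = r
  · rw [if_pos hx, add_zero]
    congr 1
    ext y
    rw [mem_neighborSet, h.adj]
    exact ⟨fun h' => h'.resolve_left fun h' => h'.1 hx, Or.inr⟩
  · rw [if_neg hx, ← Set.ncard_insert_of_notMem (a := par x) _ (Set.toFinite _)]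
    · congr 1
      ext y
      rw [mem_neighborSet, h.adj]
      simp [hx, eq_comm]
    · rintro ⟨h1, h2⟩
      have h3 := h.lt _ h1
      have h4 := h.lt x hx
      rw [h2] at h3
      omega

omit h in
/-- The vertex `v` is `x` or an ancestor of `x`. -/
def Anc (par : V → V) (v x : V) : Prop := ∃ k, par^[k] x = v

omit h in
theorem Anc.refl (v : V) : Anc par v v := ⟨0, rfl⟩

omit h in
theorem Anc.of_par {v x : V} (hx : Anc par v (par x)) : Anc par v x :=
  hx.imp' Nat.succ fun _ hk => by rwa [Function.iterate_succ_apply]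

omit h in
theorem Anc.eq_or_par {v x : V} (hx : Anc par v x) : x = v ∨ Anc par v (par x) := by
  obtain ⟨_ | k, hk⟩ := hx
  · exact Or.inl hk
  · exact Or.inr ⟨k, by rwa [Function.iterate_succ_apply] at hk⟩

omit h in
theorem Anc.trans {u v x : V} (h1 : Anc par u v) (h2 : Anc par v x) : Anc par u x := by
  obtain ⟨k, rfl⟩ := h1
  obtain ⟨l, rfl⟩ := h2
  exact ⟨k + l, Function.iterate_add_apply _ _ _ _⟩

omit h in
theorem Anc.comparable {u v x : V} (h1 : Anc par u x) (h2 : Anc par v x) :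
    Anc par u v ∨ Anc par v u := by
  obtain ⟨k, rfl⟩ := h1
  obtain ⟨l, rfl⟩ := h2
  rcases le_total k l with hkl | hkl
  · exact Or.inr ⟨l - k, by rw [← Function.iterate_add_apply, Nat.sub_add_cancel hkl]⟩
  · exact Or.inl ⟨k - l, by rw [← Function.iterate_add_apply, Nat.sub_add_cancel hkl]⟩

theorem anc_le {v x : V} (hx : Anc par v x) : μ v ≤ μ x := by
  obtain ⟨k, rfl⟩ := hx
  induction k generalizing x with
  | zero => exact le_rfl
  | succ k ih =>
    rw [Function.iterate_succ_apply]
    refine ih.trans ?_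
    by_cases hx : x = r
    · rw [hx, h.par_root]
    · exact (h.lt x hx).le

theorem not_anc_par {v : V} (hv : v ≠ r) : ¬ Anc par v (par v) := fun h' =>
  (h.lt v hv).not_ge (h.anc_le h')

theorem anc_root (x : V) : Anc par r x :=
  h.induction (Anc.refl r) (fun _ _ ih => ih.of_par) x

theorem eq_of_anc_of_par_eq {a b : V} (ha : a ≠ r) (hab : Anc par a b) (hp : par a = par b) :
    a = b := by
  rcases hab.eq_or_par with h' | h'
  exacts [h'.symm, absurd (hp ▸ h') (h.not_anc_par ha)]

/-- A descendant of greatest height has no children. -/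
theorem exists_anc_no_child [Finite V] (v : V) :
    ∃ x, Anc par v x ∧ {y | y ≠ r ∧ par y = x} = ∅ := by
  obtain ⟨x, hx, hmax⟩ := Set.exists_max_image {x | Anc par v x} μ (Set.toFinite _) ⟨v, Anc.refl v⟩
  refine ⟨x, hx, Set.eq_empty_of_forall_notMem ?_⟩
  rintro y ⟨hy, rfl⟩
  exact (h.lt y hy).not_ge (hmax y hx.of_par)

end SimpleGraph.IsRootedBy

open SimpleGraph.IsRootedBy

/-! ### Labelled trees and the clusters of their internal edges -/

namespace LabelledTree

variable {n : ℕ}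

/-- The labelled tree defined by a parent function. -/
def ofParent (V : Type) [Finite V] (r : V) (par : V → V) (μ : V → ℕ) (hr : par r = r)
    (hlt : ∀ x, x ≠ r → μ (par x) < μ x) (leaf : Fin n → V) (hinj : Function.Injective leaf)
    (hleaf : ∀ i, leaf i ≠ r ∧ ∀ y, y ≠ r → par y ≠ leaf i)
    (hint : ∀ v, v ∉ Set.range leaf → {y | y ≠ r ∧ par y = v}.Nontrivial) : LabelledTree n :=
  have h := ofParent_isRootedBy hr hlt
  have hint' : ∀ v, v ∉ Set.range leaf → 2 ≤ {y | y ≠ r ∧ par y = v}.ncard := fun v hv =>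
    Set.one_lt_ncard_iff_nontrivial.2 (hint v hv)
  { V := V
    finite := inferInstance
    graph := SimpleGraph.IsRootedBy.ofParent r par μ hlt
    isTree := h.isTree
    root := r
    leaf := leaf
    leaf_injective := hinj
    mem_range_leaf_iff := fun v => by
      classical
      rw [h.ncard_neighborSet]
      constructor
      · rintro ⟨i, rfl⟩
        have : {y | y ≠ r ∧ par y = leaf i} = ∅ :=
          Set.eq_empty_of_forall_notMem fun y hy => (hleaf i).2 y hy.1 hy.2
        rw [this, Set.ncard_empty, if_neg (hleaf i).1]
      · intro hv
        by_contra hvl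
        have := hint' v hvl
        omega
    two_le_degree_root := by
      classical
      rw [h.ncard_neighborSet]
      have := hint' r fun ⟨i, hi⟩ => (hleaf i).1 hi
      omega
    three_le_degree := fun v hv hvl => by
      classical
      rw [h.ncard_neighborSet, if_neg hv]
      have := hint' v hvl
      omega }

section Rooted

variable (T : LabelledTree n) {par : T.V → T.V} {μ : T.V → ℕ}
  (h : T.graph.IsRootedBy T.root par μ)

theorem leaf_ne_root (i : Fin n) : T.leaf i ≠ T.root := fun hi => by
  have h1 := (T.mem_range_leaf_iff (T.leaf i)).1 ⟨i, rfl⟩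
  have h2 := T.two_le_degree_root
  rw [hi] at h1
  omega

theorem root_notMem_range_leaf : T.root ∉ Set.range T.leaf := fun ⟨i, hi⟩ => T.leaf_ne_root i hi

variable {T}
include h

theorem par_ne_leaf {y : T.V} (hy : y ≠ T.root) (i : Fin n) : par y ≠ T.leaf i := fun hi => by
  classical
  have := T.finite
  have h1 := (T.mem_range_leaf_iff (T.leaf i)).1 ⟨i, rfl⟩
  rw [h.ncard_neighborSet, if_neg (T.leaf_ne_root i), Nat.add_eq_right,
    Set.ncard_eq_zero (Set.toFinite _)] at h1
  exact Set.eq_empty_iff_forall_notMem.1 h1 y ⟨hy, hi⟩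

theorem par_notMem_range_leaf {y : T.V} (hy : y ≠ T.root) : par y ∉ Set.range T.leaf :=
  fun ⟨i, hi⟩ => par_ne_leaf h hy i hi.symm

theorem children_nontrivial {v : T.V} (hv : v ∉ Set.range T.leaf) :
    {y | y ≠ T.root ∧ par y = v}.Nontrivial := by
  classical
  have := T.finite
  rw [← Set.one_lt_ncard_iff_nontrivial]
  by_cases hr : v = T.root
  · subst hr
    have := T.two_le_degree_root
    rw [h.ncard_neighborSet, if_pos rfl] at this
    omega
  · have := T.three_le_degree v hr hv
    rw [h.ncard_neighborSet, if_neg hr] at this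
    omega

theorem exists_anc_leaf (v : T.V) : ∃ i, Anc par v (T.leaf i) := by
  have := T.finite
  obtain ⟨x, hx, hx'⟩ := h.exists_anc_no_child v
  by_cases hl : x ∈ Set.range T.leaf
  · obtain ⟨i, rfl⟩ := hl
    exact ⟨i, hx⟩
  · exact absurd hx' (children_nontrivial h hl).nonempty.ne_empty

theorem not_anc_of_siblings {a b x : T.V} (ha : a ≠ T.root) (hb : b ≠ T.root) (hab : a ≠ b)
    (hp : par a = par b) (hax : Anc par a x) : ¬ Anc par b x := fun hbx => by
  rcases hax.comparable hbx with h' | h'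
  exacts [hab (h.eq_of_anc_of_par_eq ha h' hp), hab (h.eq_of_anc_of_par_eq hb h' hp.symm).symm]

/-- The labels of the leaves below an internal vertex other than the root. -/
def cluster {v : T.V} (hv : v ≠ T.root) (hl : v ∉ Set.range T.leaf) : Cluster n :=
  ⟨{i | Anc par v (T.leaf i)}, by
    -- Two elements: leaves below two different children of v.
    obtain ⟨a, ⟨ha, hav⟩, b, ⟨hb, hbv⟩, hab⟩ := children_nontrivial h hl
    obtain ⟨i, hi⟩ := exists_anc_leaf h a
    obtain ⟨j, hj⟩ := exists_anc_leaf h b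
    refine ⟨i, Anc.trans (Anc.of_par (hav ▸ Anc.refl _)) hi, j,
      Anc.trans (Anc.of_par (hbv ▸ Anc.refl _)) hj, ?_⟩
    rintro rfl
    exact not_anc_of_siblings h ha hb hab (hav.trans hbv.symm) hi hj, by
    -- Properness: the root has at least two children and at most one of them is v or above it. A
    -- leaf below another child c is not below v.
    obtain ⟨c, ⟨hc, hcr⟩, hcv⟩ : ∃ c, (c ≠ T.root ∧ par c = T.root) ∧ ¬ Anc par c v := by
      obtain ⟨a, ha, b, hb, hab⟩ := children_nontrivial h T.root_notMem_range_leaf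
      by_cases hav : Anc par a v
      · exact ⟨b, hb, not_anc_of_siblings h ha.1 hb.1 hab (ha.2.trans hb.2.symm) hav⟩
      · exact ⟨a, ha, hav⟩
    obtain ⟨i, hi⟩ := exists_anc_leaf h c
    intro huniv
    have hvi : Anc par v (T.leaf i) := by
      have : i ∈ {i | Anc par v (T.leaf i)} := huniv ▸ Set.mem_univ i
      exact this
    rcases hi.comparable hvi with h' | h'
    · exact hcv h'
    · rcases h'.eq_or_par with rfl | h''
      · exact hcv (Anc.refl _)
      · rw [hcr] at h''
        have h1 := h.anc_le h''
        have h2 := h.anc_le (h.anc_root (par v))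
        have h3 := h.lt v hv
        omega⟩

theorem mem_cluster {v : T.V} (hv : v ≠ T.root) (hl : v ∉ Set.range T.leaf) {i : Fin n} :
    i ∈ cluster h hv hl ↔ Anc par v (T.leaf i) := Iff.rfl

/-- Two vertices above a common leaf lie on one path to the root, so one is an ancestor of the
other. -/
theorem cluster_compatible {u v : T.V} (hu : u ≠ T.root) (hlu : u ∉ Set.range T.leaf)
    (hv : v ≠ T.root) (hlv : v ∉ Set.range T.leaf) :
    (cluster h hu hlu).Compatible (cluster h hv hlv) := by
  by_cases hd : Disjoint (cluster h hu hlu : Set (Fin n)) (cluster h hv hlv)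
  · exact Or.inr (Or.inr hd)
  · obtain ⟨i, hi, hj⟩ := Set.not_disjoint_iff.1 hd
    rcases Anc.comparable hi hj with h' | h'
    · exact Or.inr (Or.inl fun k hk => Anc.trans h' hk)
    · exact Or.inl fun k hk => Anc.trans h' hk

/-- Indexes an internal edge by its lower end, which makes it interchangeable with a cluster. -/
theorem internalEdges_eq :
    T.internalEdges = {e | ∃ v, v ≠ T.root ∧ v ∉ Set.range T.leaf ∧ e = s(v, par v)} := by
  ext e
  constructor
  · rintro ⟨he, hl⟩
    induction e using Sym2.ind with
    | _ x y =>
      rcases (h.adj x y).1 he with ⟨hx, rfl⟩ | ⟨hy, rfl⟩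
      · exact ⟨x, hx, hl x (by simp), rfl⟩
      · exact ⟨y, hy, hl y (by simp), Sym2.eq_swap⟩
  · rintro ⟨v, hv, hvl, rfl⟩
    refine ⟨h.adj_par hv, fun w hw => ?_⟩
    rcases Sym2.mem_iff.1 hw with rfl | rfl
    exacts [hvl, par_notMem_range_leaf h hv]

theorem edge_eq_iff {x v : T.V} (hx : x ≠ T.root) (hv : v ≠ T.root) :
    s(x, par x) = s(v, par v) ↔ x = v := by
  refine ⟨fun h' => ?_, fun h' => by rw [h']⟩
  rcases Sym2.eq_iff.1 h' with ⟨h1, -⟩ | ⟨h1, h2⟩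
  · exact h1
  · have h3 := h.lt x hx
    have h4 := h.lt v hv
    rw [h2] at h3
    rw [← h1] at h4
    omega

end Rooted

/-- Both trees are the quotient of T by the same relation, with adjacency, root and labels induced
from T. -/
theorem IsContraction.isIso {T T₁ T₂ : LabelledTree n} {E : Set (Sym2 T.V)}
    (h₁ : T.IsContraction E T₁) (h₂ : T.IsContraction E T₂) : IsIso T₁ T₂ := by
  obtain ⟨f, hf, hfE, hfa, hfr, hfl⟩ := h₁
  obtain ⟨g, hg, hgE, hga, hgr, hgl⟩ := h₂
  have hfg : ∀ x y, f x = f y ↔ g x = g y := fun x y => (hfE x y).trans (hgE x y).symm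
  let φ : T₁.V → T₂.V := fun a => g (Function.surjInv hf a)
  have hφ : ∀ x, φ (f x) = g x := fun x => (hfg _ _).1 (Function.surjInv_eq hf (f x))
  have hbij : Function.Bijective φ := by
    refine ⟨fun a b hab => ?_, fun b => ?_⟩
    · obtain ⟨x, rfl⟩ := hf a
      obtain ⟨y, rfl⟩ := hf b
      rw [hφ, hφ] at hab
      exact (hfg x y).2 hab
    · obtain ⟨x, rfl⟩ := hg b
      exact ⟨f x, hφ x⟩
  refine ⟨⟨Equiv.ofBijective φ hbij, fun {a b} => ?_⟩, ?_, fun i => ?_⟩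
  · change T₂.graph.Adj (φ a) (φ b) ↔ _
    rw [hga, hfa, hbij.1.ne_iff]
    refine and_congr_right fun _ => exists_congr fun x => exists_congr fun y => ?_
    rw [← hφ, ← hφ, hbij.1.eq_iff, hbij.1.eq_iff]
  · change φ _ = _
    rw [← hfr, hφ, hgr]
  · change φ _ = _
    rw [← hfl, hφ, hgl]

open Classical in
/-- The tree with a single internal edge, whose upper end is the root and whose lower end carries
the leaves with labels in `S`. -/
noncomputable def ofCluster (S : Cluster n) : LabelledTree n :=
  ofParent (Fin n ⊕ Bool) (Sum.inr false)
    (Sum.elim (fun i => Sum.inr (decide (i ∈ S))) fun _ => Sum.inr false)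
    -- Heights: 0 for the root, 1 for the lower end of the internal edge, 2 for all leaves,
    -- including those attached to the root.
    (Sum.elim (fun _ => 2) fun b => b.toNat) rfl
    (by
      rintro (i | _ | _) hx
      · simp only [Sum.elim_inl, Sum.elim_inr]
        cases decide (i ∈ S) <;> simp
      · exact absurd rfl hx
      · simp)
    Sum.inl Sum.inl_injective
    (fun i => ⟨Sum.inr_ne_inl.symm, by rintro (j | b) _ <;> simp⟩)
    (by
      rintro (i | _ | _) hv
      · exact absurd ⟨i, rfl⟩ hv
      · obtain ⟨i, hi⟩ := (Set.ne_univ_iff_exists_notMem _).1 S.ne_univ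
        refine ⟨Sum.inr true, by simp, Sum.inl i, ⟨by simp, ?_⟩, by simp⟩
        simpa using hi
      · obtain ⟨i, hi, j, hj, hij⟩ := S.nontrivial
        refine ⟨Sum.inl i, ⟨by simp, ?_⟩, Sum.inl j, ⟨by simp, ?_⟩, by simpa using hij⟩
        · simpa using hi
        · simpa using hj)

open Classical in
theorem ofCluster_adj {S : Cluster n} (a b : Fin n ⊕ Bool) : (ofCluster S).graph.Adj a b ↔
    (a ≠ Sum.inr false ∧
      Sum.elim (fun i => Sum.inr (decide (i ∈ S))) (fun _ => Sum.inr false) a = b) ∨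
    (b ≠ Sum.inr false ∧
      Sum.elim (fun i => Sum.inr (decide (i ∈ S))) (fun _ => Sum.inr false) b = a) :=
  Iff.rfl

theorem ofCluster_adj_root {S : Cluster n} {i : Fin n} :
    (ofCluster S).graph.Adj ((ofCluster S).leaf i) (ofCluster S).root ↔ i ∉ S :=
  (ofCluster_adj (Sum.inl i) (Sum.inr false)).trans (by simp)

/-- The cluster is recovered as the set of labels whose leaf is not adjacent to the root. -/
theorem ofCluster_injective {S S' : Cluster n} (h : IsIso (ofCluster S) (ofCluster S')) :
    S = S' := by
  obtain ⟨φ, hr, hl⟩ := h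
  refine SetLike.ext fun i => not_iff_not.1 ?_
  rw [← ofCluster_adj_root, ← ofCluster_adj_root, ← hr, ← hl, φ.map_adj_iff]

open Classical in
theorem relabel_ofCluster (g : Equiv.Perm (Fin n)) (S : Cluster n) :
    IsIso ((ofCluster S).relabel g) (ofCluster (g • S)) := by
  refine ⟨⟨Equiv.sumCongr g (Equiv.refl Bool), fun {a b} => ?_⟩, rfl, fun i => ?_⟩
  · have key : ∀ a b : Fin n ⊕ Bool, (ofCluster (g • S)).graph.Adj (Sum.map g id a)
        (Sum.map g id b) ↔ (ofCluster S).graph.Adj a b := by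
      intro a b
      have hg : ∀ i, decide (g i ∈ g • S) = decide (i ∈ S) := fun i =>
        decide_eq_decide.2 (by rw [Cluster.mem_smul, Equiv.symm_apply_apply])
      rw [ofCluster_adj, ofCluster_adj]
      rcases a with i | a <;> rcases b with j | b <;> simp [hg]
    exact key a b
  · change Sum.inl (g (g.symm i)) = Sum.inl i
    rw [Equiv.apply_symm_apply]

/-! ### Contracting all internal edges but one -/

section Contraction

variable {T : LabelledTree n} {par : T.V → T.V} {μ : T.V → ℕ}
  (h : T.graph.IsRootedBy T.root par μ)
include h

/-- Climbing from x to v never uses the edge above v. Together with `reachable_of_not_anc` this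
shows that contraction leaves at most two internal vertices, the images of v and of the root. -/
theorem reachable_of_anc {v x : T.V} (hv : v ≠ T.root) (hvx : Anc par v x)
    (hx : x ∉ Set.range T.leaf) :
    (SimpleGraph.fromEdgeSet (T.internalEdges \ {s(v, par v)})).Reachable x v := by
  induction x using h.induction with
  | root =>
    have h1 := h.anc_le hvx
    have h2 := h.anc_le (h.anc_root (par v))
    have h3 := h.lt v hv
    omega
  | step x hxr ih =>
    by_cases hxv : x = v
    · rw [hxv]
    refine SimpleGraph.Reachable.trans (SimpleGraph.Adj.reachable ?_)
      (ih (hvx.eq_or_par.resolve_left hxv) (par_notMem_range_leaf h hxr))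
    rw [SimpleGraph.fromEdgeSet_adj, internalEdges_eq h]
    exact ⟨⟨⟨x, hxr, hx, rfl⟩, fun he => hxv ((edge_eq_iff h hxr hv).1 he)⟩, (h.par_ne hxr).symm⟩

theorem reachable_of_not_anc {v x : T.V} (hv : v ≠ T.root) (hvx : ¬ Anc par v x)
    (hx : x ∉ Set.range T.leaf) :
    (SimpleGraph.fromEdgeSet (T.internalEdges \ {s(v, par v)})).Reachable x T.root := by
  induction x using h.induction with
  | root => rfl
  | step x hxr ih =>
    refine SimpleGraph.Reachable.trans (SimpleGraph.Adj.reachable ?_)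
      (ih (fun h' => hvx h'.of_par) (par_notMem_range_leaf h hxr))
    rw [SimpleGraph.fromEdgeSet_adj, internalEdges_eq h]
    refine ⟨⟨⟨x, hxr, hx, rfl⟩, fun he => hvx ?_⟩, (h.par_ne hxr).symm⟩
    rw [(edge_eq_iff h hxr hv).1 he]
    exact Anc.refl v

open Classical in
/-- Contracting all internal edges but the one above `v` gives the tree of the cluster of `v`. -/
theorem isContraction_ofCluster {v : T.V} (hv : v ≠ T.root) (hl : v ∉ Set.range T.leaf) :
    T.IsContraction (T.internalEdges \ {s(v, par v)}) (ofCluster (cluster h hv hl)) := by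
  let f : T.V → Fin n ⊕ Bool := fun x =>
    if hx : x ∈ Set.range T.leaf then Sum.inl hx.choose else Sum.inr (decide (Anc par v x))
  have hf : ∀ {x}, x ∉ Set.range T.leaf → f x = Sum.inr (decide (Anc par v x)) :=
    fun hx => dif_neg hx
  have hfl : ∀ i, f (T.leaf i) = Sum.inl i := fun i => by
    have hi : T.leaf i ∈ Set.range T.leaf := ⟨i, rfl⟩
    change dite _ _ _ = _
    rw [dif_pos hi, T.leaf_injective hi.choose_spec]
  have hfr : f T.root = Sum.inr false := by
    rw [hf T.root_notMem_range_leaf, decide_eq_false]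
    intro h'
    have h1 := h.anc_le h'
    have h2 := h.anc_le (h.anc_root (par v))
    have h3 := h.lt v hv
    omega
  have hfv : f v = Sum.inr true := by
    rw [hf hl, decide_eq_true (Anc.refl v)]
  have hfpv : f (par v) = Sum.inr false := by
    rw [hf (par_notMem_range_leaf h hv), decide_eq_false (h.not_anc_par hv)]
  -- Being below v changes only across the edge above v. Hence f is constant along contracted edges,
  -- and the parent of a leaf is sent to the end that the cluster prescribes.
  have hanc : ∀ x, x ≠ v → (Anc par v (par x) ↔ Anc par v x) := fun x hxv =>
    ⟨Anc.of_par, fun h' => h'.eq_or_par.resolve_left hxv⟩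
  have hfp : ∀ x, x ≠ T.root → x ∉ Set.range T.leaf → x ≠ v → f (par x) = f x :=
    fun x hx hxl hxv => by
      rw [hf hxl, hf (par_notMem_range_leaf h hx)]
      simp only [hanc x hxv]
  have hadj : ∀ x, x ≠ T.root → f x ≠ f (par x) →
      (ofCluster (cluster h hv hl)).graph.Adj (f x) (f (par x)) := by
    intro x hx hne
    by_cases hxl : x ∈ Set.range T.leaf
    · obtain ⟨i, rfl⟩ := hxl
      refine Or.inl ⟨by rw [hfl]; exact Sum.inl_ne_inr, ?_⟩
      rw [hfl, hf (par_notMem_range_leaf h hx)]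
      simp only [Sum.elim_inl, mem_cluster]
      rw [hanc _ fun h' => hl (h' ▸ ⟨i, rfl⟩)]
    · by_cases hxv : x = v
      · subst hxv
        rw [hfv, hfpv]
        exact Or.inl ⟨by simp, rfl⟩
      · exact absurd (hfp x hx hxl hxv).symm hne
  refine ⟨f, ?_, fun x y => ⟨fun hxy => ?_, fun hxy => ?_⟩, fun a b => ⟨fun hab => ?_, ?_⟩, hfr, hfl⟩
  · rintro (i | _ | _)
    exacts [⟨_, hfl i⟩, ⟨_, hfr⟩, ⟨_, hfv⟩]
  · by_cases hx : x ∈ Set.range T.leaf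
    · obtain ⟨i, rfl⟩ := hx
      by_cases hy : y ∈ Set.range T.leaf
      · obtain ⟨j, rfl⟩ := hy
        rw [hfl, hfl] at hxy
        rw [Sum.inl_injective hxy]
      · rw [hfl, hf hy] at hxy
        exact absurd hxy Sum.inl_ne_inr
    · by_cases hy : y ∈ Set.range T.leaf
      · obtain ⟨j, rfl⟩ := hy
        rw [hfl, hf hx] at hxy
        exact absurd hxy Sum.inr_ne_inl
      · rw [hf hx, hf hy] at hxy
        have hiff := decide_eq_decide.1 (Sum.inr_injective hxy)
        by_cases hvx : Anc par v x
        · exact (reachable_of_anc h hv hvx hx).trans (reachable_of_anc h hv (hiff.1 hvx) hy).symm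
        · exact (reachable_of_not_anc h hv hvx hx).trans
            (reachable_of_not_anc h hv (fun h' => hvx (hiff.2 h')) hy).symm
  · obtain ⟨p⟩ := hxy
    induction p with
    | nil => rfl
    | @cons x y z hxy p ih =>
      refine Eq.trans ?_ ih
      rw [SimpleGraph.fromEdgeSet_adj, internalEdges_eq h] at hxy
      obtain ⟨⟨⟨u, hu, hul, he⟩, hne⟩, -⟩ := hxy
      have huv : u ≠ v := fun h' => hne (by rw [he, h']; rfl)
      rcases Sym2.eq_iff.1 he with ⟨rfl, rfl⟩ | ⟨rfl, rfl⟩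
      exacts [(hfp _ hu hul huv).symm, hfp _ hu hul huv]
  · refine ⟨hab.ne, ?_⟩
    have key : ∀ a b : Fin n ⊕ Bool, a ≠ Sum.inr false →
        Sum.elim (fun i => Sum.inr (decide (i ∈ cluster h hv hl))) (fun _ => Sum.inr false) a = b →
        ∃ x y, f x = a ∧ f y = b ∧ T.graph.Adj x y := by
      rintro (i | _ | _) b ha rfl
      · refine ⟨T.leaf i, par (T.leaf i), hfl i, ?_, h.adj_par (T.leaf_ne_root i)⟩
        rw [hf (par_notMem_range_leaf h (T.leaf_ne_root i))]
        simp only [Sum.elim_inl, mem_cluster]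
        rw [hanc _ fun h' => hl (h' ▸ ⟨i, rfl⟩)]
      · exact absurd rfl ha
      · exact ⟨v, par v, hfv, hfpv, h.adj_par hv⟩
    rcases hab with ⟨ha, hab⟩ | ⟨hb, hba⟩
    · exact key a b ha hab
    · obtain ⟨x, y, hx, hy, hxy⟩ := key b a hb hba
      exact ⟨y, x, hy, hx, hxy.symm⟩
  · rintro ⟨hab, x, y, rfl, rfl, hxy⟩
    rcases (h.adj x y).1 hxy with ⟨hx, rfl⟩ | ⟨hy, rfl⟩
    · exact hadj x hx hab
    · exact (hadj y hy hab.symm).symm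

/-- Contractions are unique up to isomorphism, so the vertices of the simplex of T are exactly the
types of its clusters. -/
theorem vertexSet_eq : T.vertexSet = {t | ∃ (v : T.V) (hv : v ≠ T.root)
    (hl : v ∉ Set.range T.leaf), t = (ofCluster (cluster h hv hl)).type} := by
  ext t
  constructor
  · rintro ⟨e, he, T', hT', rfl⟩
    rw [internalEdges_eq h] at he
    obtain ⟨v, hv, hl, rfl⟩ := he
    exact ⟨v, hv, hl, Quotient.sound (hT'.isIso (isContraction_ofCluster h hv hl))⟩
  · rintro ⟨v, hv, hl, rfl⟩
    refine ⟨s(v, par v), ?_, _, isContraction_ofCluster h hv hl, rfl⟩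
    rw [internalEdges_eq h]
    exact ⟨v, hv, hl, rfl⟩

end Contraction

end LabelledTree

/-! ### Maximal laminar families -/

/-- A maximal family of nonempty, pairwise nested or disjoint sets. -/
structure IsHierarchy {α : Type*} (M : Set (Set α)) : Prop where
  nonempty : ∀ A ∈ M, A.Nonempty
  compatible : ∀ A ∈ M, ∀ B ∈ M, A ⊆ B ∨ B ⊆ A ∨ Disjoint A B
  maximal : ∀ A : Set α, A.Nonempty → (∀ B ∈ M, A ⊆ B ∨ B ⊆ A ∨ Disjoint A B) → A ∈ M

namespace IsHierarchy

theorem exists_superset {α : Type*} [Finite α] {F : Set (Set α)} (hF : ∀ A ∈ F, A.Nonempty)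
    (hF' : ∀ A ∈ F, ∀ B ∈ F, A ⊆ B ∨ B ⊆ A ∨ Disjoint A B) : ∃ M, F ⊆ M ∧ IsHierarchy M := by
  obtain ⟨M, hFM, hM⟩ := Finite.exists_le_maximal (a := F) (p := fun M : Set (Set α) =>
    (∀ A ∈ M, A.Nonempty) ∧ ∀ A ∈ M, ∀ B ∈ M, A ⊆ B ∨ B ⊆ A ∨ Disjoint A B) ⟨hF, hF'⟩
  refine ⟨M, hFM, hM.1.1, hM.1.2, fun A hA h => ?_⟩
  refine hM.2 (y := insert A M) ⟨?_, ?_⟩ (Set.subset_insert A M) (Set.mem_insert A M)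
  · rintro B (rfl | hB)
    exacts [hA, hM.1.1 B hB]
  · rintro B (rfl | hB) C (rfl | hC)
    · exact Or.inl subset_rfl
    · exact h C hC
    · rcases h B hB with h' | h' | h'
      exacts [Or.inr (Or.inl h'), Or.inl h', Or.inr (Or.inr h'.symm)]
    · exact hM.1.2 B hB C hC

variable {α : Type*} {M : Set (Set α)} (h : IsHierarchy M)
include h

theorem univ_mem [Nonempty α] : Set.univ ∈ M :=
  h.maximal _ Set.univ_nonempty fun B _ => Or.inr (Or.inl (Set.subset_univ B))

theorem singleton_mem (i : α) : {i} ∈ M :=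
  h.maximal _ (Set.singleton_nonempty i) fun B _ => by
    by_cases hi : i ∈ B
    · exact Or.inl (Set.singleton_subset_iff.2 hi)
    · exact Or.inr (Or.inr (Set.disjoint_singleton_left.2 hi))

theorem subset_or_subset {A B C : Set α} (hA : A ∈ M) (hB : B ∈ M) (hC : C ∈ M) (hAB : A ⊆ B)
    (hAC : A ⊆ C) : B ⊆ C ∨ C ⊆ B := by
  obtain ⟨x, hx⟩ := h.nonempty A hA
  rcases h.compatible B hB C hC with h' | h' | h'
  exacts [Or.inl h', Or.inr h', absurd (hAC hx) (Set.disjoint_left.1 h' (hAB hx))]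

/-- A proper subset in the hierarchy is contained in a least strictly larger member. -/
theorem exists_least [Finite α] [Nonempty α] {A : Set α} (hA : A ∈ M) (hu : A ≠ Set.univ) :
    ∃ B ∈ M, A ⊂ B ∧ ∀ C ∈ M, A ⊂ C → B ⊆ C := by
  obtain ⟨B, ⟨hB, hAB⟩, hmin⟩ := Set.exists_min_image {B | B ∈ M ∧ A ⊂ B} Set.ncard
    (Set.toFinite _) ⟨Set.univ, h.univ_mem, Set.ssubset_univ_iff.2 hu⟩
  refine ⟨B, hB, hAB, fun C hC hAC => ?_⟩
  rcases h.subset_or_subset hA hB hC hAB.subset hAC.subset with h' | h'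
  · exact h'
  · exact (Set.eq_of_subset_of_ncard_le h' (hmin C ⟨hC, hAC⟩)).ge

/-- The parts of a set in a hierarchy. -/
theorem exists_parts [Finite α] {A : Set α} (hA : A ∈ M) (hA' : ∀ i, {i} ≠ A) :
    ∃ P ∈ M, ∃ Q ∈ M, P ≠ Q ∧
      ∀ Y ∈ M, (Y ⊂ A ∧ ∀ C ∈ M, Y ⊂ C → A ⊆ C) ↔ Y = P ∨ Y = Q := by
  obtain ⟨i, hi⟩ := h.nonempty A hA
  -- One part is a largest proper member inside A; the other will be its complement in A.
  obtain ⟨P, ⟨hP, hPA⟩, hmax⟩ := Set.exists_max_image {B | B ∈ M ∧ B ⊂ A} Set.ncard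
    (Set.toFinite _) ⟨{i}, h.singleton_mem i,
      (Set.singleton_subset_iff.2 hi).ssubset_of_ne (hA' i)⟩
  have hP' : ∀ C ∈ M, C ⊂ A → ¬ P ⊂ C := fun C hC hCA hPC =>
    (hmax C ⟨hC, hCA⟩).not_gt (Set.ncard_lt_ncard hPC (Set.toFinite _))
  obtain ⟨a, ha⟩ := h.nonempty P hP
  obtain ⟨b, hbA, hbP⟩ := Set.exists_of_ssubset hPA
  have hdis : Disjoint (A \ P) P := Set.disjoint_sdiff_left
  -- Binary branching comes from maximality: the complement is compatible with every member of M, so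
  -- it already belongs to M.
  have hQ : A \ P ∈ M := by
    refine h.maximal _ ⟨b, hbA, hbP⟩ fun X hX => ?_
    rcases h.compatible A hA X hX with h' | h' | h'
    · exact Or.inl (Set.sdiff_subset.trans h')
    · rcases eq_or_ne X A with rfl | hne
      · exact Or.inl Set.sdiff_subset
      rcases h.compatible X hX P hP with h'' | h'' | h''
      · exact Or.inr (Or.inr (hdis.mono_right h''))
      · rcases eq_or_ne P X with rfl | hne'
        · exact Or.inr (Or.inr hdis)
        · exact absurd (h''.ssubset_of_ne hne') (hP' X hX (h'.ssubset_of_ne hne))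
      · exact Or.inr (Or.inl (Set.subset_sdiff.2 ⟨h', h''⟩))
    · exact Or.inr (Or.inr (h'.mono_left Set.sdiff_subset))
  have hQA : A \ P ⊂ A := Set.sdiff_subset.ssubset_of_ne fun h' =>
    (h'.ge (hPA.subset ha)).2 ha
  have hup : ∀ Y ∈ M, Y ⊂ A → (∀ C ∈ M, C ⊂ A → ¬ Y ⊂ C) → ∀ C ∈ M, Y ⊂ C → A ⊆ C := by
    intro Y hY hYA hm C hC hYC
    rcases h.subset_or_subset hY hA hC hYA.subset hYC.subset with h' | h'
    · exact h'
    · by_contra hAC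
      exact hm C hC ⟨h', hAC⟩ hYC
  refine ⟨P, hP, A \ P, hQ, fun h' => (h' ▸ ha : a ∈ A \ P).2 ha, fun Y hY => ⟨?_, ?_⟩⟩
  · rintro ⟨hYA, hYm⟩
    by_contra! hne
    rcases h.compatible Y hY P hP with h' | h' | h'
    · exact hPA.2 (hYm P hP (h'.ssubset_of_ne hne.1))
    · exact hP' Y hY hYA (h'.ssubset_of_ne hne.1.symm)
    · exact hQA.2 (hYm _ hQ ((Set.subset_sdiff.2 ⟨hYA.subset, h'⟩).ssubset_of_ne hne.2))
  · rintro (rfl | rfl)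
    · exact ⟨hPA, hup _ hP hPA hP'⟩
    · refine ⟨hQA, hup _ hQ hQA fun C hC hCA hQC => ?_⟩
      rcases h.compatible C hC P hP with h' | h' | h'
      · exact hbP (h' (hQC.subset ⟨hbA, hbP⟩))
      · rcases eq_or_ne P C with rfl | hne
        · exact hbP (hQC.subset ⟨hbA, hbP⟩)
        · exact hP' C hC hCA (h'.ssubset_of_ne hne)
      · exact hQC.2 (Set.subset_sdiff.2 ⟨hCA.subset, h'⟩)

end IsHierarchy

/-! ### The complex of trees as the complex of compatible families -/

namespace LabelledTree

variable {n : ℕ}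

/-- Every compatible family of clusters comes from a binary tree. -/
theorem exists_isBinary (hn : 2 ≤ n) (F : Set (Cluster n))
    (hF : ∀ S ∈ F, ∀ S' ∈ F, S.Compatible S') :
    ∃ B : LabelledTree n, B.IsBinary ∧ ∀ S ∈ F, (ofCluster S).type ∈ B.vertexSet := by
  classical
  have : Nonempty (Fin n) := ⟨⟨0, by omega⟩⟩
  have : Nontrivial (Fin n) := Fin.nontrivial_iff_two_le.2 hn
  obtain ⟨M, hFM, h⟩ := IsHierarchy.exists_superset (F := {A | ∃ S ∈ F, (S : Set (Fin n)) = A})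
    (by rintro _ ⟨S, -, rfl⟩; exact S.nonempty)
    (by rintro _ ⟨S, hS, rfl⟩ _ ⟨S', hS', rfl⟩; exact hF S hS S' hS')
  have hpar : ∀ A : M, ∃ B : M, (A.1 = Set.univ → B = A) ∧
      (A.1 ≠ Set.univ → A.1 ⊂ B.1 ∧ ∀ C ∈ M, A.1 ⊂ C → B.1 ⊆ C) := fun A => by
    by_cases hA : A.1 = Set.univ
    · exact ⟨A, fun _ => rfl, fun h' => absurd hA h'⟩
    · obtain ⟨B, hB, hB'⟩ := h.exists_least A.2 hA
      exact ⟨⟨B, hB⟩, fun h' => absurd h' hA, fun _ => hB'⟩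
  choose par hpar1 hpar2 using hpar
  -- The tree has the members of M as vertices and least larger members as parents. Maximality
  -- provides the whole set as root and the singletons as leaves; 2 ≤ n keeps them apart.
  let r : M := ⟨Set.univ, h.univ_mem⟩
  have hr : ∀ {A : M}, A ≠ r → A.1 ≠ Set.univ := fun hA h' => hA (Subtype.ext h')
  have hlt : ∀ A : M, A ≠ r → n - (par A).1.ncard < n - A.1.ncard := fun A hA => by
    have h1 := Set.ncard_lt_ncard (hpar2 A (hr hA)).1 (Set.toFinite _)
    have h2 : (par A).1.ncard ≤ n := (Set.ncard_le_card _).trans_eq (Nat.card_fin n)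
    omega
  let leaf : Fin n → M := fun i => ⟨{i}, h.singleton_mem i⟩
  have hchild : ∀ A : M, A ∉ Set.range leaf → ∃ P Q : M, P ≠ Q ∧
      {Y | Y ≠ r ∧ par Y = A} = {P, Q} := fun A hA => by
    obtain ⟨P, hP, Q, hQ, hPQ, hparts⟩ := h.exists_parts A.2 fun i hi => hA ⟨i, Subtype.ext hi⟩
    refine ⟨⟨P, hP⟩, ⟨Q, hQ⟩, fun h' => hPQ (congrArg Subtype.val h'), Set.ext fun Y => ?_⟩
    rw [Set.mem_insert_iff, Set.mem_singleton_iff, Subtype.ext_iff, Subtype.ext_iff, ← hparts Y Y.2]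
    constructor
    · rintro ⟨hY, rfl⟩
      exact hpar2 Y (hr hY)
    · rintro ⟨hYA, hYm⟩
      have hYr : Y.1 ≠ Set.univ := fun h' => hYA.2 (h' ▸ Set.subset_univ _)
      obtain ⟨h1, h2⟩ := hpar2 Y hYr
      exact ⟨fun h' => hYr (by rw [h']), Subtype.ext ((h2 _ A.2 hYA).antisymm (hYm _ (par Y).2 h1))⟩
  have hleaf : ∀ i, leaf i ≠ r ∧ ∀ Y, Y ≠ r → par Y ≠ leaf i := fun i => by
    refine ⟨fun h' => ?_, fun Y hY h' => ?_⟩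
    · exact Set.singleton_ne_univ i (congrArg Subtype.val h')
    · have h1 := (hpar2 Y (hr hY)).1
      rw [h'] at h1
      exact (h.nonempty Y Y.2).ne_empty (Set.ssubset_singleton_iff.1 h1)
  let B : LabelledTree n := ofParent M r par (fun A => n - A.1.ncard) (hpar1 r rfl) hlt leaf
    (fun i j hij => Set.singleton_injective (congrArg Subtype.val hij)) hleaf fun A hA => by
      obtain ⟨P, Q, hPQ, hch⟩ := hchild A hA
      rw [hch]
      exact Set.nontrivial_pair hPQ
  have hB : B.graph.IsRootedBy B.root par fun A => n - A.1.ncard :=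
    ofParent_isRootedBy (hpar1 r rfl) hlt
  have := B.finite
  have hcard : ∀ A : M, A ∉ Set.range leaf → {Y | Y ≠ r ∧ par Y = A}.ncard = 2 := fun A hA => by
    obtain ⟨P, Q, hPQ, hch⟩ := hchild A hA
    rw [hch, Set.ncard_pair hPQ]
  -- Ancestry in this tree is inclusion, so the cluster of the vertex S is S itself.
  have hanc : ∀ A X : M, X.1 ⊆ A.1 → Anc par A X := fun A X => by
    refine hB.induction (P := fun X : M => X.1 ⊆ A.1 → Anc par A X) (fun hX => ?_)
      (fun X hX ih hXA => ?_) X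
    · have : A = r := Subtype.ext (Set.univ_subset_iff.1 hX)
      rw [this]
      exact Anc.refl _
    · by_cases hne : X = A
      · rw [hne]
        exact Anc.refl _
      · exact Anc.of_par (ih ((hpar2 X (hr hX)).2 _ A.2
          (hXA.ssubset_of_ne fun h' => hne (Subtype.ext h'))))
  have hanc' : ∀ A X : M, Anc par A X → X.1 ⊆ A.1 := by
    rintro A X ⟨k, rfl⟩
    induction k generalizing X with
    | zero => exact subset_rfl
    | succ k ih =>
      rw [Function.iterate_succ_apply]
      refine subset_trans ?_ (ih (par X))
      by_cases hX : X.1 = Set.univ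
      · rw [hpar1 X hX]
      · exact (hpar2 X hX).1.subset
  refine ⟨B, ⟨?_, fun A hA hAl => ?_⟩, fun S hS => ?_⟩
  · have := hB.ncard_neighborSet B.root
    rw [this, if_pos rfl]
    exact hcard r B.root_notMem_range_leaf
  · have := hB.ncard_neighborSet A
    rw [this, if_neg hA]
    exact congrArg (· + 1) (hcard A hAl)
  · rw [vertexSet_eq hB]
    let v : M := ⟨S, hFM ⟨S, hS, rfl⟩⟩
    have hv : v ≠ r := fun h' => S.ne_univ (congrArg Subtype.val h')
    have hl : v ∉ Set.range leaf := by
      rintro ⟨i, hi⟩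
      have : ({i} : Set (Fin n)) = S := congrArg Subtype.val hi
      exact Set.not_nontrivial_singleton (this ▸ S.nontrivial)
    refine ⟨v, hv, hl, ?_⟩
    congr 2
    refine SetLike.ext fun i => ?_
    exact ⟨fun hi => hanc v (leaf i) (Set.singleton_subset_iff.2 hi),
      fun hi => Set.singleton_subset_iff.1 (hanc' v (leaf i) hi)⟩

/-- The vertex of the complex of trees given by a cluster. -/
noncomputable def clusterType (n : ℕ) : Cluster n ↪ TreeType n where
  toFun S := (ofCluster S).type
  inj' _ _ h := ofCluster_injective (Quotient.exact h)

theorem clusterType_smul (g : Equiv.Perm (Fin n)) (S : Cluster n) :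
    clusterType n (g • S) = g • clusterType n S :=
  (Quotient.sound (relabel_ofCluster g S)).symm

/-- Vertices of one simplex come from clusters of one tree, which are compatible; conversely
`exists_isBinary` realises a compatible family inside one binary tree. -/
theorem mem_treeComplex_faces_iff (hn : 2 ≤ n) (t : Finset (TreeType n)) :
    t ∈ (treeComplex n).faces ↔ ∃ s ∈ (laminarComplex n).faces, t = s.map (clusterType n) := by
  classical
  constructor
  · rintro ⟨ht, B, -, htB⟩
    obtain ⟨par, μ, hB⟩ := exists_of_isTree B.isTree B.root
    rw [vertexSet_eq hB] at htB
    set s : Finset (Cluster n) := Finset.univ.filter fun S => clusterType n S ∈ t with hs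
    have hts : t = s.map (clusterType n) := by
      ext x
      simp only [hs, Finset.mem_map, Finset.mem_filter, Finset.mem_univ, true_and]
      refine ⟨fun hx => ?_, ?_⟩
      · obtain ⟨v, hv, hl, rfl⟩ := htB hx
        exact ⟨_, hx, rfl⟩
      · rintro ⟨S, hS, rfl⟩
        exact hS
    refine ⟨s, ⟨?_, fun S hS S' hS' => ?_⟩, hts⟩
    · rw [hts] at ht
      exact Finset.map_nonempty.1 ht
    · obtain ⟨v, hv, hl, h1⟩ := htB (Finset.mem_filter.1 hS).2
      obtain ⟨v', hv', hl', h2⟩ := htB (Finset.mem_filter.1 hS').2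
      rw [(clusterType n).injective h1, (clusterType n).injective h2]
      exact cluster_compatible hB hv hl hv' hl'
  · rintro ⟨s, ⟨hs, hcomp⟩, rfl⟩
    obtain ⟨B, hB, hsB⟩ := exists_isBinary hn (s : Set (Cluster n)) hcomp
    refine ⟨hs.map, B, hB, ?_⟩
    rw [Finset.coe_map]
    rintro _ ⟨S, hS, rfl⟩
    exact hsB S hS

end LabelledTree

theorem mainTheorem4 (R : Type*) [CommRing R] (n : ℕ) (hn : 3 ≤ n) :
    Nonempty ((SimplicialHomology.homologyRep R (treeComplex_isInvariant n) (n - 3)).Equiv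
      (SimplicialHomology.homologyRep R (orderComplex_partitionLattice_isInvariant n) (n - 3))) := by
  obtain ⟨e⟩ := SimplicialHomology.homologyRep_equiv_of_embedding (R := R)
    (LabelledTree.clusterType n) LabelledTree.clusterType_smul
    (LabelledTree.mem_treeComplex_faces_iff (by omega)) (Cluster.laminarComplex_isInvariant n)
    (treeComplex_isInvariant n) (n - 3)
  -- With truncated subtraction, (n - 3) + 1 = n - 2 relies on 3 ≤ n.
  obtain ⟨e'⟩ := laminarComplex_homologyRep_equiv R (n := n) (q := n - 3) (by omega)
  exact ⟨e.symm.trans e'⟩
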